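/- Let $M$ be a smooth manifold without boundary (Hausdorff, second countable, not necessarily compact) with a smooth Riemannian metric $g$, let $Z\subset M$ be a nonempty compact connected embedded submanifold without boundary, and let $F,h\colon M\to\mathbb R$ be smooth. Assume that $Z\subset\mathrm{Crit}\,F$, that $F$ is Morse–Bott along $Z$, i.e. $\ker\mathrm{Hess}_zF=T_zZ$ for all $z\in Z$, that $F|_Z=0$, and that $$\mathcal S:=\inf\{|F(x)| : x\in\mathrm{Crit}\,F\setminus Z\}>0$$ (with $\mathcal S=\infty$ if $\mathrm{Crit}\,F=Z$). Fix $k\in\mathbb N$ and smooth functions $\beta^\pm_\infty\colon\mathbb R\to[0,1]$ with $\beta^+_\infty$ increasing, $\beta^+_\infty=0$ on $(-\infty,-1]$, $\beta^+_\infty=1$ on $[0,\infty)$, and $\beta^-_\infty$ decreasing, $\beta^-_\infty=1$ on $(-\infty,0]$, $\beta^-_\infty=0$ on $[1,\infty)$. Fix also functions $\beta_r\colon\mathbb R\to[0,1]$, $r\ge 0$, smooth in $(r,s)\in[0,\infty)\times\mathbb R$, such that * $\beta_r(s)=0$ for $s\le -1$ and for $s\ge (k+1)r+1$; * $0\le\beta_r'\le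 2$ on $(-1,0)$ and $-2\le\beta_r'\le 0$ on $((k+1)r,(k+1)r+1)$; * $\beta_r=1$ on $[0,(k+1)r]$ if $r\ge 1$, and $\beta_r'=0$ on $[0,(k+1)r]$ if $r\le 1$; * $\beta_r\to 0$ in the strong $C^\infty$-topology as $r\to 0$; * $\beta_r\to\beta_\infty^+$ and $\beta_r(\cdot+(k+1)r)\to\beta_\infty^-$ in $C^\infty_{loc}$ as $r\to\infty$. Put $G_{r,s}:=\beta_r(s)h+(1-\beta_r(s))F$. Let $\mathcal M$ be the set of pairs $(r,\gamma)$ with $r\ge 0$ and $\gamma\colon\mathbb R\to M$ a solution of $\gamma'(s)+\nabla^gG_{r,s}(\gamma(s))=0$ with $\int_{\mathbb R}|\gamma'(s)|^2\,ds<\infty$. For $R\ge 0$ put $$\mathcal M_{[0,R]}(Z):=\{(r,\gamma)\in\mathcal M : r\in[0,R],\ \lim_{s\to-\infty}\gamma(s)\in Z \text{ and } \lim_{s\to+\infty}\gamma(s)\in Z\}.$$ Let $W^{1,2}(\mathbb R,M)$ be the space of continuous curves $\gamma\colon\mathbb R\to M$ that have limits $\gamma(\pm\infty)\in M$ and are such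 that, for every smooth $f\colon M\to\mathbb R$, the function $u=f\circ\gamma$ is locally absolutely continuous, $u'\in L^2(\mathbb R)$, $u-f(\gamma(-\infty))\in L^2((-\infty,0))$ and $u-f(\gamma(+\infty))\in L^2((0,\infty))$. Give it the coarsest topology for which, for every smooth $f$, the numbers $f(\gamma(\pm\infty))$ and the functions $u'$, $u-f(\gamma(-\infty))$, $u-f(\gamma(+\infty))$ depend continuously on $\gamma$, in $\mathbb R$ and in $L^2(\mathbb R)$, $L^2((-\infty,0))$, $L^2((0,\infty))$ respectively. **Theorem.** Assume that 1. $\|h-F\|:=\sup_M(h-F)-\inf_M(h-F)<\mathcal S$, and 2. for all sequences $(r_n,\gamma_n)\in\mathcal M$ and $s_n\in\mathbb R$, the sequence $\gamma_n(\cdot-s_n)$ has a subsequence that converges in $C^\infty_{loc}(\mathbb R,M)$. Then for every $R\ge 0$ the moduli space $\mathcal M_{[0,R]}(Z)$ is contained in $[0,R]\times W^{1,2}(\mathbb R,M)$ and is a compact subset of it. -/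

import Mathlib

open Set Filter Topology MeasureTheory Manifold
open scoped ContDiff

noncomputable section

namespace MorseBott

/-! ### Cut-off functions -/

/-- `b : ℝ → [0,1]` is smooth and increasing, equal to `0` on `(-∞,-1]` and to `1` on `[0,∞)`. -/
structure IsRisingCutoff (b : ℝ → ℝ) : Prop where
  smooth : ContDiff ℝ ∞ b
  mem_Icc : ∀ s, b s ∈ Icc (0 : ℝ) 1
  eq_zero : ∀ s : ℝ, s ≤ -1 → b s = 0
  eq_one : ∀ s, 0 ≤ s → b s = 1
  mono : Monotone b

/-- `b : ℝ → [0,1]` is smooth and decreasing, equal to `1` on `(-∞,0]` and to `0` on `[1,∞)`. -/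
structure IsFallingCutoff (b : ℝ → ℝ) : Prop where
  smooth : ContDiff ℝ ∞ b
  mem_Icc : ∀ s, b s ∈ Icc (0 : ℝ) 1
  eq_one : ∀ s : ℝ, s ≤ 0 → b s = 1
  eq_zero : ∀ s, 1 ≤ s → b s = 0
  anti : Antitone b

/-- The smooth family `β r : ℝ → [0,1]`, `r ≥ 0`, of cut-off functions with plateau
`[0, (k+1)r]`. Values of `β r` at negative `r` play no role. -/
structure IsCutoffFamily (k : ℕ) (bPlus bMinus : ℝ → ℝ) (β : ℝ → ℝ → ℝ) : Prop where
  rising : IsRisingCutoff bPlus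
  falling : IsFallingCutoff bMinus
  smooth : ContDiffOn ℝ ∞ (fun p : ℝ × ℝ => β p.1 p.2) (Ici 0 ×ˢ univ)
  mem_Icc : ∀ r : ℝ, 0 ≤ r → ∀ s, β r s ∈ Icc (0 : ℝ) 1
  eq_zero : ∀ r : ℝ, 0 ≤ r → ∀ s : ℝ, (s ≤ -1 ∨ ((k : ℝ) + 1) * r + 1 ≤ s) → β r s = 0
  deriv_left : ∀ r : ℝ, 0 ≤ r → ∀ s ∈ Ioo (-1 : ℝ) 0, 0 ≤ deriv (β r) s ∧ deriv (β r) s ≤ 2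
  deriv_right : ∀ r : ℝ, 0 ≤ r → ∀ s ∈ Ioo (((k : ℝ) + 1) * r) ((k + 1) * r + 1),
    deriv (β r) s ≤ 0 ∧ -2 ≤ deriv (β r) s
  eq_one : ∀ r : ℝ, 1 ≤ r → ∀ s ∈ Icc (0 : ℝ) (((k : ℝ) + 1) * r), β r s = 1
  deriv_plateau : ∀ r : ℝ, 0 ≤ r → r ≤ 1 → ∀ s ∈ Icc (0 : ℝ) (((k : ℝ) + 1) * r), deriv (β r) s = 0
  /-- `β r → 0` as `r → 0` in the strong `C^∞` topology: all derivatives converge uniformly on `ℝ`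
  (by `eq_zero` the supports lie in one compact interval for `r ≤ 1`). -/
  tendsto_zero : ∀ m : ℕ, TendstoUniformly (fun r => iteratedDeriv m (β r)) 0 (𝓝[>] 0)
  /-- `β r → bPlus` as `r → ∞` in `C^∞_loc`. -/
  tendsto_plus : ∀ m : ℕ, TendstoLocallyUniformly
    (fun r => iteratedDeriv m (β r)) (iteratedDeriv m bPlus) atTop
  /-- `β r (· + (k+1)r) → bMinus` as `r → ∞` in `C^∞_loc`. -/
  tendsto_minus : ∀ m : ℕ, TendstoLocallyUniformly
    (fun r : ℝ => iteratedDeriv m (fun s => β r (s + ((k : ℝ) + 1) * r))) (iteratedDeriv m bMinus) atTop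

/-! ### Smooth functions, Riemannian metrics, gradients -/

/-- Smooth Riemannian metrics on a manifold of dimension `n`. -/
abbrev Metric (n : ℕ) (M : Type*) [TopologicalSpace M]
    [ChartedSpace (EuclideanSpace ℝ (Fin n)) M] [IsManifold (𝓡 n) ∞ M] : Type _ :=
  Bundle.ContMDiffRiemannianMetric (IB := 𝓡 n) ∞ (EuclideanSpace ℝ (Fin n))
    (fun x : M => TangentSpace (𝓡 n) x)

section Functions

variable {n : ℕ} {M : Type*} [TopologicalSpace M] [ChartedSpace (EuclideanSpace ℝ (Fin n)) M]

/-- The differential `df(x) : T_xM → ℝ`. -/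
def differential (n : ℕ) {M : Type*} [TopologicalSpace M]
    [ChartedSpace (EuclideanSpace ℝ (Fin n)) M] (f : M → ℝ) (x : M) :
    TangentSpace (𝓡 n) x →L[ℝ] ℝ :=
  mfderiv (𝓡 n) 𝓘(ℝ, ℝ) f x

/-- The set of critical points of `f`. -/
def criticalSet (n : ℕ) {M : Type*} [TopologicalSpace M]
    [ChartedSpace (EuclideanSpace ℝ (Fin n)) M] (f : M → ℝ) : Set M :=
  {x | differential n f x = 0}

/-- The Hessian of `f` at `x`, computed in the preferred chart at `x`, which is the chart that
identifies `T_xM` with `ℝⁿ`. At a critical point it does not depend on the chart, and it is only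
used there. -/
def hessian (n : ℕ) {M : Type*} [TopologicalSpace M]
    [ChartedSpace (EuclideanSpace ℝ (Fin n)) M] (f : M → ℝ) (x : M) :
    TangentSpace (𝓡 n) x →L[ℝ] TangentSpace (𝓡 n) x →L[ℝ] ℝ :=
  fderiv ℝ (fderiv ℝ (f ∘ (extChartAt (𝓡 n) x).symm)) (extChartAt (𝓡 n) x x)

/-- The oscillation `sup f - inf f`, an extended real number. -/
def oscillation {M : Type*} (f : M → ℝ) : EReal :=
  (⨆ x, ((f x : ℝ) : EReal)) - ⨅ x, ((f x : ℝ) : EReal)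

/-- The spectral gap `inf {|F x| : x ∈ Crit F \ Z}`, equal to `∞` if there is no such `x`. -/
def spectralGap (n : ℕ) {M : Type*} [TopologicalSpace M]
    [ChartedSpace (EuclideanSpace ℝ (Fin n)) M] (F : M → ℝ) (Z : Set M) : EReal :=
  ⨅ x ∈ criticalSet n F \ Z, ((|F x| : ℝ) : EReal)

/-- The Morse-Bott condition along the submanifold `Z = ι(N)`: all points of `Z` are critical for
`F`, and `ker Hess_z F = T_zZ` for all `z ∈ Z`, where `T_zZ` is the image of `dι`. -/
def IsMorseBottAlong {d : ℕ} {N : Type*} [TopologicalSpace N]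
    [ChartedSpace (EuclideanSpace ℝ (Fin d)) N] (F : M → ℝ) (ι : N → M) : Prop :=
  range ι ⊆ criticalSet n F ∧
    ∀ y : N, (hessian n F (ι y)).toLinearMap.ker = (mfderiv (𝓡 d) (𝓡 n) ι y).toLinearMap.range

variable [IsManifold (𝓡 n) ∞ M]

theorem exists_gradient (g : Metric n M) (x : M) (ℓ : TangentSpace (𝓡 n) x →L[ℝ] ℝ) :
    ∃ v : TangentSpace (𝓡 n) x, ∀ w, g.inner x v w = ℓ w := by
  have hfin : FiniteDimensional ℝ (TangentSpace (𝓡 n) x) :=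
    inferInstanceAs (FiniteDimensional ℝ (EuclideanSpace ℝ (Fin n)))
  let B : TangentSpace (𝓡 n) x →ₗ[ℝ] Module.Dual ℝ (TangentSpace (𝓡 n) x) :=
    { toFun := fun v => (g.inner x v).toLinearMap
      map_add' := fun v w => by ext u; simp
      map_smul' := fun c v => by ext u; simp }
  have hinj : Function.Injective B := by
    rw [← LinearMap.ker_eq_bot, LinearMap.ker_eq_bot']
    intro v hv
    by_contra hne
    have h1 := g.pos x v hne
    have h2 : g.inner x v v = 0 := by
      have := congrArg (fun φ : Module.Dual ℝ (TangentSpace (𝓡 n) x) => φ v) hv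
      simpa [B] using this
    exact absurd h2 h1.ne'
  have hsurj : Function.Surjective B :=
    (LinearMap.injective_iff_surjective_of_finrank_eq_finrank
      (Subspace.dual_finrank_eq (K := ℝ) (V := TangentSpace (𝓡 n) x)).symm).1 hinj
  obtain ⟨v, hv⟩ := hsurj ℓ.toLinearMap
  exact ⟨v, fun w => congrArg (fun φ : Module.Dual ℝ (TangentSpace (𝓡 n) x) => φ w) hv⟩

/-- The gradient of `f` with respect to the metric `g`. -/
def gradient (g : Metric n M) (f : M → ℝ) (x : M) : TangentSpace (𝓡 n) x :=
  (exists_gradient g x (differential n f x)).choose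

theorem inner_gradient (g : Metric n M) (f : M → ℝ) (x : M) (w : TangentSpace (𝓡 n) x) :
    g.inner x (gradient g f x) w = differential n f x w :=
  (exists_gradient g x (differential n f x)).choose_spec w

end Functions

/-! ### Moduli spaces of gradient lines -/

/-- `G_{r,s} = β_r(s) h + (1 - β_r(s)) F`. -/
def interpolation {M : Type*} (β : ℝ → ℝ → ℝ) (h F : M → ℝ) (r s : ℝ) (x : M) : ℝ :=
  β r s * h x + (1 - β r s) * F x

section Moduli

variable {n : ℕ} {M : Type*} [TopologicalSpace M] [ChartedSpace (EuclideanSpace ℝ (Fin n)) M]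

/-- The velocity `γ'(s)` of a curve. -/
def velocity (n : ℕ) {M : Type*} [TopologicalSpace M]
    [ChartedSpace (EuclideanSpace ℝ (Fin n)) M] (γ : ℝ → M) (s : ℝ) :
    TangentSpace (𝓡 n) (γ s) :=
  mfderiv 𝓘(ℝ, ℝ) (𝓡 n) γ s (1 : ℝ)

variable [IsManifold (𝓡 n) ∞ M]

/-- The energy `∫ |γ'(s)|² ds`. -/
def energy (g : Metric n M) (γ : ℝ → M) : ENNReal :=
  ∫⁻ s : ℝ, ENNReal.ofReal (g.inner (γ s) (velocity n γ s) (velocity n γ s))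

/-- The space of all pairs `(r, γ)` with `r ≥ 0` and `γ` a gradient line of `G_{r,s}` of finite
energy. (Solutions of the gradient equation are automatically smooth.) -/
def moduliSpace (g : Metric n M) (β : ℝ → ℝ → ℝ) (h F : M → ℝ) : Set (ℝ × (ℝ → M)) :=
  {p | 0 ≤ p.1 ∧ ContMDiff 𝓘(ℝ, ℝ) (𝓡 n) ∞ p.2 ∧
    (∀ s, velocity n p.2 s + gradient g (interpolation β h F p.1 s) (p.2 s) = 0) ∧
    energy g p.2 < ⊤}

/-- The pairs `(r, γ)` in the moduli space with `r ∈ [0,R]` and `lim_{s → ±∞} γ(s) ∈ Z`. -/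
def moduliSpaceIcc (g : Metric n M) (β : ℝ → ℝ → ℝ) (h F : M → ℝ) (Z : Set M) (R : ℝ) :
    Set (ℝ × (ℝ → M)) :=
  {p | p ∈ moduliSpace g β h F ∧ p.1 ∈ Icc 0 R ∧
    (∃ z ∈ Z, Tendsto p.2 atTop (𝓝 z)) ∧ (∃ z ∈ Z, Tendsto p.2 atBot (𝓝 z))}

/-- `u j → γ` in `C^∞_loc(ℝ, M)`: `γ` is smooth, and near every time `s₀`, in the chart around
`γ s₀`, all derivatives of `u j` converge uniformly to those of `γ`. -/
def TendstoSmoothLoc (n : ℕ) {M : Type*} [TopologicalSpace M]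
    [ChartedSpace (EuclideanSpace ℝ (Fin n)) M] (u : ℕ → ℝ → M) (γ : ℝ → M) : Prop :=
  ContMDiff 𝓘(ℝ, ℝ) (𝓡 n) ∞ γ ∧
  ∀ s₀ : ℝ, ∃ U : Set ℝ, IsOpen U ∧ s₀ ∈ U ∧
    MapsTo γ U (extChartAt (𝓡 n) (γ s₀)).source ∧
    (∀ᶠ j in atTop, MapsTo (u j) U (extChartAt (𝓡 n) (γ s₀)).source) ∧
    ∀ m : ℕ, TendstoUniformlyOn
      (fun j => iteratedDeriv m (extChartAt (𝓡 n) (γ s₀) ∘ u j))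
      (iteratedDeriv m (extChartAt (𝓡 n) (γ s₀) ∘ γ)) atTop U

/-- The `C^∞_loc`-compactness assumption: for all sequences `(r j, γ j)` in the moduli space and
all shifts `s j`, a subsequence of `γ j (· - s j)` converges in `C^∞_loc(ℝ, M)`. -/
def SmoothLocCompactness (g : Metric n M) (β : ℝ → ℝ → ℝ) (h F : M → ℝ) : Prop :=
  ∀ (r : ℕ → ℝ) (γ : ℕ → ℝ → M) (s : ℕ → ℝ), (∀ j, (r j, γ j) ∈ moduliSpace g β h F) →
    ∃ φ : ℕ → ℕ, StrictMono φ ∧ ∃ η : ℝ → M,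
      TendstoSmoothLoc n (fun j t => γ (φ j) (t - s (φ j))) η

end Moduli

/-! ### The space `W^{1,2}(ℝ, M)` of curves that converge at both ends

A real function `u` with prescribed limits `a` at `-∞` and `b` at `+∞` is of class `W^{1,2}` if it
is locally absolutely continuous, `u'` is in `L²(ℝ)`, `u - a` is in `L²(-∞,0)` and `u - b` is in
`L²(0,∞)`. A curve in `M` is of class `W^{1,2}` if its compositions with all smooth functions
`M → ℝ` are; for an embedding of `M` into a Euclidean space it is equivalent that its coordinate
functions are. The limits may vary: a sequence of curves converges if the limits at `±∞` converge
and the curves converge in `W^{1,2}` relative to their limits. For prescribed limits this is the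
usual `W^{1,2}`-topology on curves from one point to another. -/

/-- The step function with value `a` on `(-∞,0)` and `b` on `[0,∞)`. -/
def endStep (a b : ℝ) (s : ℝ) : ℝ := if s < 0 then a else b

/-- `u` is of class `W^{1,2}` relative to the limit `a` at `-∞` and the limit `b` at `+∞`. -/
structure IsW12 (u : ℝ → ℝ) (a b : ℝ) : Prop where
  absCont : ∀ c d : ℝ, AbsolutelyContinuousOnInterval u c d
  memLp_sub : MemLp (fun s => u s - endStep a b s) 2 volume
  memLp_deriv : MemLp (deriv u) 2 volume

/-- Curves in `M` of class `W^{1,2}` that converge to points of `M` at `±∞`. The limits are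
determined by the curve when `M` is Hausdorff. -/
structure W12Curve (n : ℕ) (M : Type*) [TopologicalSpace M]
    [ChartedSpace (EuclideanSpace ℝ (Fin n)) M] where
  toFun : ℝ → M
  left : M
  right : M
  continuous : Continuous toFun
  tendsto_left : Tendsto toFun atBot (𝓝 left)
  tendsto_right : Tendsto toFun atTop (𝓝 right)
  isW12 : ∀ f : ContMDiffMap (𝓡 n) 𝓘(ℝ, ℝ) M ℝ ∞,
    IsW12 (fun s => f (toFun s)) (f left) (f right)

namespace W12Curve

variable {n : ℕ} {M : Type*} [TopologicalSpace M] [ChartedSpace (EuclideanSpace ℝ (Fin n)) M]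

/-- For `u = f ∘ γ`: the two limits of `u`, the class in `L²` of `u` minus its limits, and the class
in `L²` of `u'`. -/
def coords (f : ContMDiffMap (𝓡 n) 𝓘(ℝ, ℝ) M ℝ ∞) (c : W12Curve n M) :
    (ℝ × ℝ) × (Lp ℝ 2 (volume : Measure ℝ) × Lp ℝ 2 (volume : Measure ℝ)) :=
  ((f c.left, f c.right), ((c.isW12 f).memLp_sub.toLp _, (c.isW12 f).memLp_deriv.toLp _))

/-- The `W^{1,2}`-topology. -/
instance : TopologicalSpace (W12Curve n M) :=
  ⨅ f : ContMDiffMap (𝓡 n) 𝓘(ℝ, ℝ) M ℝ ∞, TopologicalSpace.induced (coords f) inferInstance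

end W12Curve

end MorseBott

end

/-! Let `b = K - m` be the oscillation of `h - F`, which is less than the spectral gap.
Differentiating `G_{r,s}` along a gradient line from `Z` to `Z` shows that the drop of `F` between
the two ends, where the cut-off vanishes, is controlled by `b`; hence `|F| ≤ b` on both ends
(`IsFlowLine.abs_le_of_tendsto`). This bound, unlike convergence to `Z`, is closed under pointwise
limits.

The bound also forces convergence. If points far out on the ends stayed away from `Z`, recentring
there would produce a gradient line of `F` itself with `|F| ≤ b`. Both of its asymptotic values of
`F` are critical values attained below the gap, hence `0`, so it lies in `Z`
(`IsFlowLine.mem_of_abs_le`). Thus no breaking occurs and the ends are uniformly close to `Z`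
(`exists_forall_mem_of_isOpen`).

Near `Z` the Morse-Bott condition gives the Łojasiewicz inequality `|F| ≤ C |∇F|²`
(`exists_lojasiewicz`). It makes `F`, and with it every smooth function of the curve, converge
exponentially at a rate uniform over the moduli space (`exists_exponential_decay`). So the limit
condition and the bound on `F` describe the same set (`CompactnessSetting.moduliSpaceIcc_eq`), all
these lines are of class `W^{1,2}`, and the exponential serves as dominating function that turns
pointwise convergence into `W^{1,2}`-convergence (`CompactnessSetting.tendsto_w12Curve`).

Everything is tested on smooth functions `f : M → ℝ`: along a line, `f` has derivative `-g(∇G_{r,s},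
∇f)`, and the pairings `g(∇f₁, ∇f₂)` are again smooth functions on `M`. -/

namespace MorseBott

/-! ### Differentials, gradients and the metric in coordinates -/

section Charts

variable {n : ℕ} {M : Type*} [TopologicalSpace M] [ChartedSpace (EuclideanSpace ℝ (Fin n)) M]
  [IsManifold (𝓡 n) ∞ M]

/-- The vector in `T_xM` with coordinates `a` in the preferred chart at `x₀`. -/
noncomputable def ofCoord (x₀ x : M) : EuclideanSpace ℝ (Fin n) →L[ℝ] TangentSpace (𝓡 n) x :=
  (trivializationAt (EuclideanSpace ℝ (Fin n)) (TangentSpace (𝓡 n)) x₀).symmL ℝ x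

theorem exists_ofCoord_eq {x₀ x : M} (hx : x ∈ (extChartAt (𝓡 n) x₀).source)
    (v : TangentSpace (𝓡 n) x) : ∃ a, ofCoord x₀ x a = v :=
  ⟨_, (trivializationAt (EuclideanSpace ℝ (Fin n)) (TangentSpace (𝓡 n) (M := M)) x₀).symmL_continuousLinearMapAt
    (R := ℝ) (by simpa using hx) v⟩

theorem ofCoord_injective {x₀ x : M} (hx : x ∈ (extChartAt (𝓡 n) x₀).source) :
    Function.Injective (ofCoord (n := n) x₀ x) := fun a b hab => by
  have h := fun c => (trivializationAt (EuclideanSpace ℝ (Fin n))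
    (TangentSpace (𝓡 n) (M := M)) x₀).continuousLinearMapAt_symmL (R := ℝ) (b := x) (by simpa using hx) c
  rw [← h a, ← h b]
  exact congrArg _ hab

theorem ofCoord_eq_mfderiv {x₀ x : M} (hx : x ∈ (extChartAt (𝓡 n) x₀).source)
    (a : EuclideanSpace ℝ (Fin n)) :
    ofCoord x₀ x a = mfderiv 𝓘(ℝ, EuclideanSpace ℝ (Fin n)) (𝓡 n) (extChartAt (𝓡 n) x₀).symm
      (extChartAt (𝓡 n) x₀ x) a := by
  have h := TangentBundle.symmL_trivializationAt (I := 𝓡 n) (𝕜 := ℝ) (x₀ := x₀) (x := x)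
    (by simpa using hx)
  rw [ofCoord, h]
  have hr : range (𝓡 n) = univ := ModelWithCorners.range_eq_univ _
  rw [hr, mfderivWithin_univ]
  rfl

theorem differential_ofCoord {f : M → ℝ} {x₀ x : M} (hx : x ∈ (extChartAt (𝓡 n) x₀).source)
    (hf : MDifferentiableAt (𝓡 n) 𝓘(ℝ, ℝ) f x) (a : EuclideanSpace ℝ (Fin n)) :
    differential n f x (ofCoord x₀ x a) =
      fderiv ℝ (f ∘ (extChartAt (𝓡 n) x₀).symm) (extChartAt (𝓡 n) x₀ x) a := by
  rw [ofCoord_eq_mfderiv hx]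
  have hinv : (extChartAt (𝓡 n) x₀).symm (extChartAt (𝓡 n) x₀ x) = x :=
    (extChartAt (𝓡 n) x₀).left_inv hx
  have h1 : MDifferentiableAt 𝓘(ℝ, EuclideanSpace ℝ (Fin n)) (𝓡 n) (extChartAt (𝓡 n) x₀).symm
      (extChartAt (𝓡 n) x₀ x) := by
    have := mdifferentiableWithinAt_extChartAt_symm (I := 𝓡 n) (x := x₀)
      ((extChartAt (𝓡 n) x₀).map_source hx)
    rwa [ModelWithCorners.range_eq_univ, mdifferentiableWithinAt_univ] at this
  have h2 := mfderiv_comp_of_eq (I := 𝓘(ℝ, EuclideanSpace ℝ (Fin n))) (I' := 𝓡 n)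
    (I'' := 𝓘(ℝ, ℝ)) (x := extChartAt (𝓡 n) x₀ x) (y := x) hf h1 hinv
  have h3 : ∀ y, y = x → ∀ w : EuclideanSpace ℝ (Fin n),
      (differential n f x : EuclideanSpace ℝ (Fin n) →L[ℝ] ℝ) w =
        (mfderiv (𝓡 n) 𝓘(ℝ, ℝ) f y : EuclideanSpace ℝ (Fin n) →L[ℝ] ℝ) w := by
    rintro _ rfl w
    rfl
  rw [← mfderiv_eq_fderiv, h2]
  exact h3 _ hinv _

theorem contDiffOn_comp_extChartAt_symm {f : M → ℝ} (hf : ContMDiff (𝓡 n) 𝓘(ℝ, ℝ) ∞ f) (x₀ : M) :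
    ContDiffOn ℝ ∞ (f ∘ (extChartAt (𝓡 n) x₀).symm) (extChartAt (𝓡 n) x₀).target :=
  contMDiffOn_iff_contDiffOn.1 (hf.comp_contMDiffOn (contMDiffOn_extChartAt_symm x₀))

theorem contDiffAt_comp_extChartAt_symm {f : M → ℝ} (hf : ContMDiff (𝓡 n) 𝓘(ℝ, ℝ) ∞ f) {x₀ x : M}
    (hx : x ∈ (extChartAt (𝓡 n) x₀).source) :
    ContDiffAt ℝ ∞ (f ∘ (extChartAt (𝓡 n) x₀).symm) (extChartAt (𝓡 n) x₀ x) :=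
  (contDiffOn_comp_extChartAt_symm hf x₀).contDiffAt
    ((isOpen_extChartAt_target x₀).mem_nhds ((extChartAt (𝓡 n) x₀).map_source hx))

theorem contMDiffAt_fderiv_comp_extChartAt_symm {f : M → ℝ} (hf : ContMDiff (𝓡 n) 𝓘(ℝ, ℝ) ∞ f)
    (x₀ : M) : ContMDiffAt (𝓡 n) 𝓘(ℝ, EuclideanSpace ℝ (Fin n) →L[ℝ] ℝ) ∞
      (fun x => fderiv ℝ (f ∘ (extChartAt (𝓡 n) x₀).symm) (extChartAt (𝓡 n) x₀ x)) x₀ := by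
  have h1 : ContDiffAt ℝ ∞ (fderiv ℝ (f ∘ (extChartAt (𝓡 n) x₀).symm)) (extChartAt (𝓡 n) x₀ x₀) :=
    (contDiffAt_comp_extChartAt_symm hf (mem_extChartAt_source x₀)).fderiv_right (by simp)
  exact h1.contMDiffAt.comp x₀ contMDiffAt_extChartAt

/-- The metric in coordinates. -/
theorem exists_contMDiffAt_metric (g : Metric n M) (x₀ : M) :
    ∃ G : M → EuclideanSpace ℝ (Fin n) →L[ℝ] EuclideanSpace ℝ (Fin n) →L[ℝ] ℝ,
      ContMDiffAt (𝓡 n) 𝓘(ℝ, EuclideanSpace ℝ (Fin n) →L[ℝ] EuclideanSpace ℝ (Fin n) →L[ℝ] ℝ) ∞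
        G x₀ ∧
      ∀ x ∈ (extChartAt (𝓡 n) x₀).source, ∀ a b,
        G x a b = g.inner x (ofCoord x₀ x a) (ofCoord x₀ x b) := by
  refine ⟨_, ((contMDiffAt_hom_bundle _).1 (g.contMDiff x₀)).2, fun x hx a b => ?_⟩
  have hb : x ∈ (trivializationAt (EuclideanSpace ℝ (Fin n)) (TangentSpace (𝓡 n)) x₀).baseSet := by
    simpa using hx
  refine (inCoordinates_apply_eq₂ hb hb (by simp)).trans ?_
  rw [ofCoord, Bundle.Trivialization.symmL_apply _ hb, Bundle.Trivialization.symmL_apply _ hb]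
  exact congrArg (fun L : ℝ →ₗ[ℝ] ℝ => L _)
    (Bundle.Trivial.linearMapAt_trivialization ℝ M ℝ x)

theorem exists_continuousLinearEquiv_of_pos {G : EuclideanSpace ℝ (Fin n) →L[ℝ] EuclideanSpace ℝ (Fin n) →L[ℝ] ℝ}
    (hG : ∀ a, a ≠ 0 → 0 < G a a) :
    ∃ e : EuclideanSpace ℝ (Fin n) ≃L[ℝ] (EuclideanSpace ℝ (Fin n) →L[ℝ] ℝ), (e : _ →L[ℝ] _) = G := by
  have hinj : Function.Injective G := by
    rw [injective_iff_map_eq_zero]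
    intro a ha
    by_contra hne
    have := hG a hne
    simp [ha] at this
  have hdim : Module.finrank ℝ (EuclideanSpace ℝ (Fin n)) =
      Module.finrank ℝ (EuclideanSpace ℝ (Fin n) →L[ℝ] ℝ) :=
    (InnerProductSpace.toDual ℝ (EuclideanSpace ℝ (Fin n))).toLinearEquiv.finrank_eq
  refine ⟨(LinearEquiv.ofInjectiveOfFinrankEq G.toLinearMap hinj hdim).toContinuousLinearEquiv, ?_⟩
  ext a b
  rfl

theorem metric_ofCoord_pos (g : Metric n M) {x₀ x : M} (hx : x ∈ (extChartAt (𝓡 n) x₀).source)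
    (a : EuclideanSpace ℝ (Fin n)) (ha : a ≠ 0) :
    0 < g.inner x (ofCoord x₀ x a) (ofCoord x₀ x a) :=
  g.pos x _ fun h => ha (ofCoord_injective hx (by rw [h, map_zero]))

/-- The pairing of the gradients of two smooth functions is smooth. -/
theorem contMDiff_differential_gradient (g : Metric n M) {f h : M → ℝ}
    (hf : ContMDiff (𝓡 n) 𝓘(ℝ, ℝ) ∞ f) (hh : ContMDiff (𝓡 n) 𝓘(ℝ, ℝ) ∞ h) :
    ContMDiff (𝓡 n) 𝓘(ℝ, ℝ) ∞ (fun x => differential n f x (gradient g h x)) := by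
  intro x₀
  obtain ⟨G, hG, hGeq⟩ := exists_contMDiffAt_metric g x₀
  have hpos : ∀ x ∈ (extChartAt (𝓡 n) x₀).source, ∀ a, a ≠ 0 → 0 < G x a a := fun x hx a ha => by
    rw [hGeq x hx]
    exact metric_ofCoord_pos g hx a ha
  obtain ⟨e, he⟩ := exists_continuousLinearEquiv_of_pos (hpos x₀ (mem_extChartAt_source x₀))
  have hinv : ContMDiffAt (𝓡 n) 𝓘(ℝ, (EuclideanSpace ℝ (Fin n) →L[ℝ] ℝ) →L[ℝ]
      EuclideanSpace ℝ (Fin n)) ∞ (fun x => (G x).inverse) x₀ := by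
    have h1 : ContDiffAt ℝ ∞ ContinuousLinearMap.inverse (G x₀) := by
      rw [← he]
      exact contDiffAt_map_inverse e
    exact h1.contMDiffAt.comp x₀ hG
  have hA := contMDiffAt_fderiv_comp_extChartAt_symm hf x₀
  have hB := contMDiffAt_fderiv_comp_extChartAt_symm hh x₀
  -- In coordinates the pairing is `df (G⁻¹ dh)`, with `G` the matrix of the metric.
  refine (hA.clm_apply (hinv.clm_apply hB)).congr_of_eventuallyEq ?_
  filter_upwards [extChartAt_source_mem_nhds (I := 𝓡 n) x₀] with x hx
  obtain ⟨c, hc⟩ := exists_ofCoord_eq hx (gradient g h x)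
  obtain ⟨e', he'⟩ := exists_continuousLinearEquiv_of_pos (hpos x hx)
  have hGc : G x c = fderiv ℝ (h ∘ (extChartAt (𝓡 n) x₀).symm) (extChartAt (𝓡 n) x₀ x) := by
    ext b
    rw [hGeq x hx, hc, inner_gradient,
      differential_ofCoord hx (hh.mdifferentiable (by simp) x)]
  rw [← hc, differential_ofCoord hx (hf.mdifferentiable (by simp) x), ← hGc, ← he',
    ContinuousLinearMap.inverse_equiv]
  simp

/-- Coordinate vectors have locally bounded length. -/
theorem eventually_metric_ofCoord_le (g : Metric n M) (x₀ : M) :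
    ∃ C : ℝ, 0 ≤ C ∧ ∀ᶠ x in 𝓝 x₀, ∀ a, g.inner x (ofCoord x₀ x a) (ofCoord x₀ x a) ≤ C * ‖a‖ ^ 2 := by
  obtain ⟨G, hG, hGeq⟩ := exists_contMDiffAt_metric g x₀
  have hc : Tendsto (fun x => ‖G x‖) (𝓝 x₀) (𝓝 ‖G x₀‖) :=
    Tendsto.comp (continuous_norm.tendsto (G x₀)) hG.continuousAt
  refine ⟨‖G x₀‖ + 1, by positivity, ?_⟩
  filter_upwards [extChartAt_source_mem_nhds (I := 𝓡 n) x₀,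
    hc.eventually_lt_const (lt_add_one ‖G x₀‖)] with x hx hlt a
  rw [← hGeq x hx]
  calc G x a a ≤ ‖G x a a‖ := le_abs_self _
    _ ≤ ‖G x‖ * ‖a‖ * ‖a‖ := (G x).le_opNorm₂ a a
    _ ≤ (‖G x₀‖ + 1) * ‖a‖ * ‖a‖ := by gcongr
    _ = _ := by ring

/-- The quadratic polynomial `t ↦ |v + t w|²` is nonnegative, so its discriminant is not positive.
-/
theorem inner_cauchy_schwarz (g : Metric n M) (x : M) (v w : TangentSpace (𝓡 n) x) :
    g.inner x v w ^ 2 ≤ g.inner x v v * g.inner x w w := by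
  have hnn : ∀ u : TangentSpace (𝓡 n) x, 0 ≤ g.inner x u u := fun u => by
    rcases eq_or_ne u 0 with rfl | hu
    · simp
    · exact (g.pos x u hu).le
  have h : ∀ t : ℝ, 0 ≤ g.inner x w w * (t * t) + (2 * g.inner x v w) * t + g.inner x v v := by
    intro t
    have := hnn (v + t • w)
    simp only [map_add, map_smul, add_apply, smul_apply, smul_eq_mul,
      g.symm x w v] at this
    linarith
  have := discrim_le_zero h
  rw [discrim] at this
  linarith

theorem differential_gradient_self_nonneg (g : Metric n M) (f : M → ℝ) (x : M) :
    0 ≤ differential n f x (gradient g f x) := by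
  rw [← inner_gradient g]
  rcases eq_or_ne (gradient g f x) 0 with hu | hu
  · simp [hu]
  · exact (g.pos x _ hu).le

theorem differential_sq_le (g : Metric n M) (f : M → ℝ) (x : M) (v : TangentSpace (𝓡 n) x) :
    differential n f x v ^ 2 ≤ differential n f x (gradient g f x) * g.inner x v v := by
  have := inner_cauchy_schwarz g x (gradient g f x) v
  rwa [inner_gradient, inner_gradient] at this

theorem mem_criticalSet_of_gradient (g : Metric n M) {f : M → ℝ} {x : M}
    (h : differential n f x (gradient g f x) = 0) : x ∈ criticalSet n f := by
  refine ContinuousLinearMap.ext fun v => ?_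
  have := differential_sq_le g f x v
  rw [h, zero_mul] at this
  exact pow_eq_zero_iff two_ne_zero |>.1 (le_antisymm this (sq_nonneg _))

end Charts

/-! ### Smooth functions separate points and tangent vectors -/

section Separation

variable {n : ℕ} {M : Type*} [TopologicalSpace M] [T2Space M]
  [ChartedSpace (EuclideanSpace ℝ (Fin n)) M] [IsManifold (𝓡 n) ∞ M]

theorem exists_contMDiff_support_subset (n : ℕ) {M : Type*} [TopologicalSpace M] [T2Space M]
    [ChartedSpace (EuclideanSpace ℝ (Fin n)) M] [IsManifold (𝓡 n) ∞ M] {z : M} {V : Set M}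
    (hV : V ∈ 𝓝 z) :
    ∃ f : M → ℝ, ContMDiff (𝓡 n) 𝓘(ℝ, ℝ) ∞ f ∧ f z = 1 ∧ ∀ x ∉ V, f x = 0 := by
  obtain ⟨f, -, hf⟩ := (SmoothBumpFunction.nhds_basis_tsupport (I := 𝓡 n) z).mem_iff.1 hV
  exact ⟨f, f.contMDiff, f.eq_one, fun x hx => by_contra fun h => hx (hf (subset_tsupport f h))⟩

/-- Tangent vectors are separated by the differentials of smooth functions. -/
theorem eq_zero_of_forall_differential_eq_zero {x : M} {v : TangentSpace (𝓡 n) x}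
    (h : ∀ f : M → ℝ, ContMDiff (𝓡 n) 𝓘(ℝ, ℝ) ∞ f → differential n f x v = 0) : v = 0 := by
  obtain ⟨χ⟩ : Nonempty (SmoothBumpFunction (𝓡 n) x) := inferInstance
  obtain ⟨a, rfl⟩ := exists_ofCoord_eq (mem_extChartAt_source (I := 𝓡 n) x) v
  suffices a = 0 by rw [this, map_zero]
  have hlin : ∀ ℓ : EuclideanSpace ℝ (Fin n) →L[ℝ] ℝ, ℓ a = 0 := by
    intro ℓ
    -- A linear function of the coordinates, cut off by a bump function, is globally smooth and has
    -- differential `ℓ` at `x`.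
    have hs : ContMDiffOn (𝓡 n) 𝓘(ℝ, ℝ) ∞ (fun y => ℓ (extChartAt (𝓡 n) x y))
        (chartAt (EuclideanSpace ℝ (Fin n)) x).source :=
      ℓ.contMDiff.comp_contMDiffOn contMDiffOn_extChartAt
    have hsm := χ.contMDiff_smul hs
    have h0 := h _ hsm
    rw [differential_ofCoord (mem_extChartAt_source x) (hsm.mdifferentiable (by simp) x)] at h0
    have heq : ((fun y => χ y • ℓ (extChartAt (𝓡 n) x y)) ∘ (extChartAt (𝓡 n) x).symm)
        =ᶠ[𝓝 (extChartAt (𝓡 n) x x)] ℓ := by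
      have h1 : ∀ᶠ y in 𝓝 (extChartAt (𝓡 n) x x), χ ((extChartAt (𝓡 n) x).symm y) = 1 := by
        have hc : Tendsto (extChartAt (𝓡 n) x).symm (𝓝 (extChartAt (𝓡 n) x x)) (𝓝 x) := by
          simpa using (continuousAt_extChartAt_symm (I := 𝓡 n) x).tendsto
        exact hc.eventually χ.eventuallyEq_one
      filter_upwards [h1, (isOpen_extChartAt_target (I := 𝓡 n) x).mem_nhds
        (mem_extChartAt_target x)] with y hy hyt
      simp only [Function.comp_apply, hy, (extChartAt (𝓡 n) x).right_inv hyt, one_smul]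
    rw [heq.fderiv_eq, ℓ.fderiv] at h0
    exact h0
  have := hlin (innerSL ℝ a)
  simpa using this

end Separation

/-! ### The Łojasiewicz inequality near a Morse-Bott critical manifold -/

section Lojasiewicz

/-- The Łojasiewicz inequality with exponent `1/2` for a function which is Morse-Bott along the
image of `j`. -/
theorem eventually_abs_le_norm_fderiv_sq {E E' : Type*} [NormedAddCommGroup E] [NormedSpace ℝ E]
    [FiniteDimensional ℝ E] [NormedAddCommGroup E'] [NormedSpace ℝ E'] [FiniteDimensional ℝ E']
    {f : E → ℝ} {p : E} (hf : ContDiffAt ℝ ∞ f p) {j : E' → E} {J : E' →L[ℝ] E} {q : E'}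
    (hj : HasStrictFDerivAt j J q) (hq : j q = p)
    (hzero : ∀ᶠ y in 𝓝 q, f (j y) = 0 ∧ fderiv ℝ f (j y) = 0)
    (hker : (fderiv ℝ (fderiv ℝ f) p).toLinearMap.ker = J.toLinearMap.range) :
    ∃ C : ℝ, 0 ≤ C ∧ ∀ᶠ x in 𝓝 p, |f x| ≤ C * ‖fderiv ℝ f x‖ ^ 2 := by
  have := FiniteDimensional.complete ℝ E
  have := FiniteDimensional.complete ℝ E'
  set H := fderiv ℝ (fderiv ℝ f) p with hH
  obtain ⟨V, hV⟩ := Submodule.exists_isCompl H.toLinearMap.ker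
  have hstrict : HasStrictFDerivAt (fderiv ℝ f) H p :=
    ((hf.fderiv_right (m := ∞) (by simp)).hasStrictFDerivAt (by simp))
  -- `H` is bounded below on the complement of its kernel
  obtain ⟨K₀, hK₀, hanti⟩ := LinearMap.exists_antilipschitzWith
    (H.toLinearMap.comp V.subtype) (by
      rw [LinearMap.ker_eq_bot']
      intro v hv
      have h1 : (v : E) ∈ H.toLinearMap.ker ⊓ V := ⟨hv, v.2⟩
      rw [hV.inf_eq_bot] at h1
      exact Subtype.ext ((Submodule.mem_bot ℝ).1 h1))
  have hbelow : ∀ v : V, ‖v‖ ≤ K₀ * ‖H v‖ := fun v => hanti.le_mul_norm (map_zero _) v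
  have hK₀' : (0 : ℝ) < K₀ := by exact_mod_cast hK₀
  -- the tubular parametrization is open
  have hΨ : HasStrictFDerivAt (fun z : E' × V => j z.1 + (z.2 : E)) (J.coprod V.subtypeL) (q, 0) := by
    have h1 : HasStrictFDerivAt (fun z : E' × V => j z.1) (J.comp (ContinuousLinearMap.fst ℝ E' V))
        (q, 0) := HasStrictFDerivAt.comp (g := j) (q, (0 : V)) hj hasStrictFDerivAt_fst
    have h2 : HasStrictFDerivAt (fun z : E' × V => (z.2 : E))
        (V.subtypeL.comp (ContinuousLinearMap.snd ℝ E' V)) (q, 0) :=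
      (V.subtypeL.comp (ContinuousLinearMap.snd ℝ E' V)).hasStrictFDerivAt
    have h3 : J.coprod V.subtypeL = J.comp (ContinuousLinearMap.fst ℝ E' V) +
        V.subtypeL.comp (ContinuousLinearMap.snd ℝ E' V) := by
      ext z <;> simp
    rw [h3]
    exact h1.add h2
  have hopen : map (fun z : E' × V => j z.1 + (z.2 : E)) (𝓝 (q, 0)) = 𝓝 p := by
    have := hΨ.map_nhds_eq_of_surj (by
      rw [eq_top_iff, ← hV.sup_eq_top, hker]
      refine sup_le ?_ ?_
      · rintro _ ⟨y, rfl⟩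
        exact ⟨(y, 0), by simp⟩
      · intro v hv
        exact ⟨(0, ⟨v, hv⟩), by simp⟩)
    simpa [hq] using this
  obtain ⟨K, s, hs, hLip⟩ := hstrict.exists_lipschitzOnWith
  have hdiff : ∀ᶠ x in 𝓝 p, DifferentiableAt ℝ f x :=
    ((hf.of_le (m := 1) (by simp)).eventually (by simp)).mono fun x hx =>
      hx.differentiableAt (by simp)
  obtain ⟨ε, hε, hball⟩ := Metric.mem_nhds_iff.1 (inter_mem hs hdiff)
  refine ⟨K * (2 * K₀) ^ 2, by positivity, ?_⟩
  rw [← hopen, eventually_map]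
  have hc1 : Tendsto (fun z : E' × V => j z.1) (𝓝 (q, 0)) (𝓝 p) := by
    rw [← hq]
    exact hj.continuousAt.tendsto.comp continuous_fst.continuousAt
  have hc2 : Tendsto (fun z : E' × V => j z.1 + (z.2 : E)) (𝓝 (q, 0)) (𝓝 p) := hopen.le
  have hlittle := hstrict.isLittleO.def (c := (2 * K₀)⁻¹) (by positivity)
  have hlittle' := (hc2.prodMk_nhds hc1).eventually hlittle
  filter_upwards [hlittle', hc1 (Metric.ball_mem_nhds p hε), hc2 (Metric.ball_mem_nhds p hε),
    (continuous_fst.tendsto (q, (0 : V))).eventually hzero] with ⟨y, v⟩ h1 h2 h3 ⟨h4, h5⟩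
  simp only [mem_preimage] at h1 h2 h3 h4 h5 ⊢
  rw [h5, sub_zero, add_sub_cancel_left] at h1
  -- The gradient vanishes at the foot point `j y`, so at `j y + v` it is `H v` up to an error `‖v‖
  -- / (2 K₀)`. As `‖v‖ ≤ K₀ ‖H v‖`, the error absorbs only half of `‖v‖`.
  have hv : ‖(v : E)‖ ≤ 2 * K₀ * ‖fderiv ℝ f (j y + v)‖ := by
    have h6 : ‖H v‖ ≤ ‖fderiv ℝ f (j y + v)‖ + (2 * K₀ : ℝ)⁻¹ * ‖(v : E)‖ := by
      have := norm_sub_le (fderiv ℝ f (j y + v)) (fderiv ℝ f (j y + v) - H v)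
      rw [sub_sub_cancel] at this
      linarith
    have h7 := (hbelow v).trans (mul_le_mul_of_nonneg_left h6 hK₀'.le)
    have h8 : (K₀ : ℝ) * ((2 * K₀ : ℝ)⁻¹ * ‖(v : E)‖) = ‖(v : E)‖ / 2 := by field_simp
    rw [mul_add, h8] at h7
    have : ‖v‖ = ‖(v : E)‖ := rfl
    linarith
  have hseg : segment ℝ (j y) (j y + v) ⊆ Metric.ball p ε :=
    (convex_ball p ε).segment_subset h2 h3
  -- Along the segment the gradient is at most `K ‖v‖`, so `f`, which vanishes at `j y`, is at most
  -- `K ‖v‖²`.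
  have hmv := (convex_segment (𝕜 := ℝ) (j y) (j y + v)).norm_image_sub_le_of_norm_fderiv_le
    (f := f) (C := K * ‖(v : E)‖) (fun x hx => (hball (hseg hx)).2) (fun x hx => by
      have h9 := hLip.norm_sub_le (hball (hseg hx)).1 (hball h2).1
      rw [h5, sub_zero] at h9
      refine h9.trans (mul_le_mul_of_nonneg_left ?_ K.2)
      have := norm_sub_le_of_mem_segment hx
      simpa using this)
    (left_mem_segment ℝ _ _) (right_mem_segment ℝ _ _)
  rw [h4, sub_zero, add_sub_cancel_left, Real.norm_eq_abs] at hmv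
  calc |f (j y + v)| ≤ K * ‖(v : E)‖ * ‖(v : E)‖ := hmv
    _ = K * ‖(v : E)‖ ^ 2 := by ring
    _ ≤ K * (2 * K₀ * ‖fderiv ℝ f (j y + v)‖) ^ 2 := by gcongr
    _ = _ := by ring

variable {n d : ℕ} {M : Type*} [TopologicalSpace M] [ChartedSpace (EuclideanSpace ℝ (Fin n)) M]
  [IsManifold (𝓡 n) ∞ M] {N : Type*} [TopologicalSpace N]
  [ChartedSpace (EuclideanSpace ℝ (Fin d)) N]

/-- Cauchy-Schwarz bounds `df(v)²` by `|∇f|² |v|²`, and coordinate vectors have locally bounded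
`g`-length. This passes from the Euclidean norm of `df` to the `g`-norm of the gradient. -/
theorem eventually_norm_fderiv_sq_le (g : Metric n M) {f : M → ℝ}
    (hf : ContMDiff (𝓡 n) 𝓘(ℝ, ℝ) ∞ f) (x₀ : M) :
    ∃ C : ℝ, 0 ≤ C ∧ ∀ᶠ x in 𝓝 x₀,
      ‖fderiv ℝ (f ∘ (extChartAt (𝓡 n) x₀).symm) (extChartAt (𝓡 n) x₀ x)‖ ^ 2 ≤
        C * differential n f x (gradient g f x) := by
  obtain ⟨C, hC0, hC⟩ := eventually_metric_ofCoord_le g x₀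
  refine ⟨C, hC0, ?_⟩
  filter_upwards [hC, extChartAt_source_mem_nhds (I := 𝓡 n) x₀] with x hx hxs
  have hw := differential_gradient_self_nonneg g f x
  suffices ‖fderiv ℝ (f ∘ (extChartAt (𝓡 n) x₀).symm) (extChartAt (𝓡 n) x₀ x)‖ ≤
      √(C * differential n f x (gradient g f x)) by
    rw [← Real.sq_sqrt (mul_nonneg hC0 hw)]
    gcongr
  refine ContinuousLinearMap.opNorm_le_bound _ (Real.sqrt_nonneg _) fun a => ?_
  rw [← differential_ofCoord hxs (hf.mdifferentiable (by simp) x), Real.norm_eq_abs]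
  refine abs_le_of_sq_le_sq ?_ (by positivity)
  rw [mul_pow, Real.sq_sqrt (mul_nonneg hC0 hw)]
  calc _ ≤ differential n f x (gradient g f x) * g.inner x (ofCoord x₀ x a) (ofCoord x₀ x a) :=
        differential_sq_le g f x _
    _ ≤ differential n f x (gradient g f x) * (C * ‖a‖ ^ 2) :=
        mul_le_mul_of_nonneg_left (hx a) hw
    _ = _ := by ring

/-- The Euclidean inequality applies in the chart at `ι y`, the one in which the Hessian is defined,
with `j` the coordinate expression of `ι`. -/
theorem eventually_abs_le_differential_gradient (g : Metric n M) {F : M → ℝ}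
    (hF : ContMDiff (𝓡 n) 𝓘(ℝ, ℝ) ∞ F) {ι : N → M} (hι : ContMDiff (𝓡 d) (𝓡 n) ∞ ι)
    (hMB : IsMorseBottAlong (n := n) (d := d) F ι) (hFZ : ∀ z ∈ range ι, F z = 0) (y : N) :
    ∃ C : ℝ, 0 ≤ C ∧ ∀ᶠ x in 𝓝 (ι y), |F x| ≤ C * differential n F x (gradient g F x) := by
  set j : EuclideanSpace ℝ (Fin d) → EuclideanSpace ℝ (Fin n) :=
    writtenInExtChartAt (𝓡 d) (𝓡 n) y ι with hjdef
  set q := extChartAt (𝓡 d) y y with hqdef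
  have hjsm : ContDiffAt ℝ ∞ j q := by
    have := (contMDiffAt_iff.1 (hι y)).2
    rwa [ModelWithCorners.range_eq_univ, contDiffWithinAt_univ] at this
  have hq : j q = extChartAt (𝓡 n) (ι y) (ι y) := by
    simp [hjdef, writtenInExtChartAt, hqdef]
  have hJ : (mfderiv (𝓡 d) (𝓡 n) ι y).toLinearMap.range = (fderiv ℝ j q).toLinearMap.range := by
    have h1 : mfderiv (𝓡 d) (𝓡 n) ι y = fderivWithin ℝ j (range (𝓡 d)) q :=
      (hι.mdifferentiable (by simp) y).mfderiv
    rw [ModelWithCorners.range_eq_univ, fderivWithin_univ] at h1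
    rw [h1]
    rfl
  have hcont : ContinuousAt (fun u => ι ((extChartAt (𝓡 d) y).symm u)) q := by
    refine ContinuousAt.comp (g := ι) hι.continuous.continuousAt ?_
    exact continuousAt_extChartAt_symm (I := 𝓡 d) y
  have hval : ι ((extChartAt (𝓡 d) y).symm q) = ι y := by simp [hqdef]
  have hsrc : ∀ᶠ u in 𝓝 q, ι ((extChartAt (𝓡 d) y).symm u) ∈ (extChartAt (𝓡 n) (ι y)).source :=
    hcont.eventually (by simp only [hval]; exact extChartAt_source_mem_nhds (I := 𝓡 n) (ι y))
  obtain ⟨C₁, hC₁, h₁⟩ := eventually_abs_le_norm_fderiv_sq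
    (contDiffAt_comp_extChartAt_symm hF (mem_extChartAt_source (I := 𝓡 n) (ι y)))
    (hjsm.hasStrictFDerivAt (by simp)) hq (by
      filter_upwards [hsrc] with u hu
      have hju : j u = extChartAt (𝓡 n) (ι y) (ι ((extChartAt (𝓡 d) y).symm u)) := rfl
      refine ⟨?_, ?_⟩
      · rw [hju, Function.comp_apply, (extChartAt (𝓡 n) (ι y)).left_inv hu]
        exact hFZ _ (mem_range_self _)
      · ext a
        rw [hju, ← differential_ofCoord hu (hF.mdifferentiable (by simp) _),
          show differential n F _ = 0 from hMB.1 (mem_range_self _)]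
        rfl) ((hMB.2 y).trans hJ)
  obtain ⟨C₂, hC₂, h₂⟩ := eventually_norm_fderiv_sq_le g hF (ι y)
  refine ⟨C₁ * C₂, by positivity, ?_⟩
  filter_upwards [h₂, (continuousAt_extChartAt (I := 𝓡 n) (ι y)).eventually h₁,
    extChartAt_source_mem_nhds (I := 𝓡 n) (ι y)] with x hx2 hx1 hxs
  rw [Function.comp_apply, (extChartAt (𝓡 n) (ι y)).left_inv hxs] at hx1
  calc |F x| ≤ _ := hx1
    _ ≤ C₁ * (C₂ * differential n F x (gradient g F x)) := by gcongr
    _ = _ := by ring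

theorem exists_lojasiewicz [CompactSpace N] (g : Metric n M) {F : M → ℝ}
    (hF : ContMDiff (𝓡 n) 𝓘(ℝ, ℝ) ∞ F) {ι : N → M} (hι : ContMDiff (𝓡 d) (𝓡 n) ∞ ι)
    (hMB : IsMorseBottAlong (n := n) (d := d) F ι) (hFZ : ∀ z ∈ range ι, F z = 0) :
    ∃ C : ℝ, 0 < C ∧ ∃ U : Set M, IsOpen U ∧ range ι ⊆ U ∧
      ∀ x ∈ U, |F x| ≤ C * differential n F x (gradient g F x) := by
  have hw := differential_gradient_self_nonneg g F
  suffices h : ∃ C : ℝ, 0 < C ∧ ∀ᶠ x in 𝓝ˢ (range ι),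
      |F x| ≤ C * differential n F x (gradient g F x) by
    obtain ⟨C, hC, hev⟩ := h
    obtain ⟨U, hU, hZU, h⟩ := mem_nhdsSet_iff_exists.1 hev
    exact ⟨C, hC, U, hU, hZU, h⟩
  refine (isCompact_range hι.continuous).induction_on
    (p := fun s => ∃ C : ℝ, 0 < C ∧ ∀ᶠ x in 𝓝ˢ s, |F x| ≤ C * differential n F x (gradient g F x))
    ⟨1, one_pos, by simp⟩ ?_ ?_ ?_
  · rintro s t hst ⟨C, hC, h⟩
    exact ⟨C, hC, h.filter_mono (nhdsSet_mono hst)⟩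
  · rintro s t ⟨C, hC, h⟩ ⟨C', hC', h'⟩
    refine ⟨max C C', lt_max_of_lt_left hC, ?_⟩
    rw [nhdsSet_union, eventually_sup]
    exact ⟨h.mono fun x hx => hx.trans (mul_le_mul_of_nonneg_right (le_max_left _ _) (hw x)),
      h'.mono fun x hx => hx.trans (mul_le_mul_of_nonneg_right (le_max_right _ _) (hw x))⟩
  · rintro _ ⟨y, rfl⟩
    obtain ⟨C, hC, h⟩ := eventually_abs_le_differential_gradient g hF hι hMB hFZ y
    obtain ⟨t, ht, hto, hyt⟩ := eventually_nhds_iff.1 h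
    refine ⟨t, mem_nhdsWithin_of_mem_nhds (hto.mem_nhds hyt), C + 1, by positivity, ?_⟩
    rw [hto.nhdsSet_eq, eventually_principal]
    exact fun x hx => (ht x hx).trans (mul_le_mul_of_nonneg_right (by linarith) (hw x))

end Lojasiewicz

/-! ### Exponential decay from differential inequalities -/

section Decay

variable {a u e u' : ℝ → ℝ} {T C D : ℝ}

/-- The derivative of `a exp(s/C)` is `(a/C - e) exp(s/C) ≤ 0`. -/
theorem exp_mul_le_of_hasDerivAt (hC : 0 < C) (ha : ∀ s, T ≤ s → HasDerivAt a (-(e s)) s)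
    (hle : ∀ s, T ≤ s → a s ≤ C * e s) {s : ℝ} (hs : T ≤ s) :
    a s * Real.exp (s / C) ≤ a T * Real.exp (T / C) := by
  have hd : ∀ s, T ≤ s → HasDerivAt (fun s => a s * Real.exp (s / C))
      (-(e s) * Real.exp (s / C) + a s * (Real.exp (s / C) * (1 / C))) s := fun s hs =>
    (ha s hs).mul (((hasDerivAt_id s).div_const C).exp)
  refine antitoneOn_of_deriv_nonpos (convex_Ici T)
    (fun s hs => (hd s hs).continuousAt.continuousWithinAt)
    (fun s hs => (hd s (interior_subset hs)).differentiableAt.differentiableWithinAt)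
    (fun s hs => ?_) self_mem_Ici hs hs
  have hs' := interior_subset hs
  rw [(hd s hs').deriv]
  have h1 : a s * (1 / C) ≤ e s := by
    rw [mul_one_div, div_le_iff₀ hC, mul_comm]
    exact hle s hs'
  nlinarith [Real.exp_pos (s / C)]

/-- A function whose derivative is controlled by the square root of the dissipation of an
exponentially decaying function converges exponentially fast. -/
theorem abs_sub_le_exp_of_hasDerivAt (hC : 0 < C) (hD : 0 ≤ D)
    (ha : ∀ s, T ≤ s → HasDerivAt a (-(e s)) s) (hu : ∀ s, T ≤ s → HasDerivAt u (u' s) s)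
    (hnn : ∀ s, T ≤ s → 0 ≤ a s) (hle : ∀ s, T ≤ s → a s ≤ C * e s)
    (hu' : ∀ s, T ≤ s → u' s ^ 2 ≤ D * e s) {s t : ℝ} (hs : T ≤ s) (hst : s ≤ t) :
    |u t - u s| ≤ (D * C + a T * Real.exp (T / C)) * Real.exp (-(s / (2 * C))) := by
  -- `Φ` is built so that `|u'| ≤ -Φ'`. Then `u + Φ` and `-u + Φ` are both nonincreasing, and `Φ t ≥
  -- 0` gives `|u t - u s| ≤ Φ s`.
  set Φ : ℝ → ℝ := fun s => D * C * Real.exp (-(s / (2 * C))) + a s * Real.exp (s / (2 * C))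
  set Φ' : ℝ → ℝ := fun s => D * C * (Real.exp (-(s / (2 * C))) * -(1 / (2 * C))) +
    (-(e s) * Real.exp (s / (2 * C)) + a s * (Real.exp (s / (2 * C)) * (1 / (2 * C))))
  have hΦ : ∀ s, T ≤ s → HasDerivAt Φ (Φ' s) s := fun s hs =>
    ((((hasDerivAt_id s).div_const (2 * C)).neg.exp).const_mul (D * C)).add
      ((ha s hs).mul (((hasDerivAt_id s).div_const (2 * C)).exp))
  have henn : ∀ s, T ≤ s → 0 ≤ e s := fun s hs =>
    nonneg_of_mul_nonneg_right ((hnn s hs).trans (hle s hs)) hC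
  have hbound : ∀ s, T ≤ s → |u' s| ≤ -Φ' s := by
    intro s hs
    set E₁ := Real.exp (-(s / (2 * C)))
    set E₂ := Real.exp (s / (2 * C))
    have hE : E₁ * E₂ = 1 := by rw [← Real.exp_add]; simp
    have hE₁ : 0 < E₁ := Real.exp_pos _
    have hE₂ : 0 < E₂ := Real.exp_pos _
    -- Arithmetic-geometric mean inequality for `D e = (D E₁)(e E₂)`; the weights balance the two
    -- exponentials.
    have h1 : |u' s| ≤ (D * E₁ + e s * E₂) / 2 := by
      refine abs_le_of_sq_le_sq ((hu' s hs).trans ?_)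
        (by have := mul_nonneg hD hE₁.le; have := mul_nonneg (henn s hs) hE₂.le; linarith)
      have : D * e s = (D * E₁) * (e s * E₂) := by linear_combination (-(D * e s)) * hE
      rw [this]
      nlinarith [sq_nonneg (D * E₁ - e s * E₂)]
    have h2 : a s * (1 / (2 * C)) ≤ e s / 2 := by
      rw [mul_one_div, div_le_div_iff₀ (by positivity) two_pos]
      nlinarith [hle s hs]
    have h3 : D * C * (E₁ * -(1 / (2 * C))) = -(D * E₁) / 2 := by field_simp
    have h4 := mul_le_mul_of_nonneg_right h2 hE₂.le
    show _ ≤ -(D * C * (E₁ * -(1 / (2 * C))) + (-(e s) * E₂ + a s * (E₂ * (1 / (2 * C)))))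
    rw [h3]
    nlinarith
  have hmono : ∀ σ : ℝ, |σ| = 1 → σ * u t + Φ t ≤ σ * u s + Φ s := by
    intro σ hσ
    have hd : ∀ s, T ≤ s → HasDerivAt (fun s => σ * u s + Φ s) (σ * u' s + Φ' s) s := fun s hs =>
      ((hu s hs).const_mul σ).add (hΦ s hs)
    refine antitoneOn_of_deriv_nonpos (convex_Ici T)
      (fun s hs => (hd s hs).continuousAt.continuousWithinAt)
      (fun s hs => (hd s (interior_subset hs)).differentiableAt.differentiableWithinAt)
      (fun s hs => ?_) (mem_Ici.2 hs) (mem_Ici.2 (hs.trans hst)) hst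
    have hs' := interior_subset hs
    rw [(hd s hs').deriv]
    have h1 : σ * u' s ≤ |u' s| := (le_abs_self _).trans (by rw [abs_mul, hσ, one_mul])
    linarith [hbound s hs']
  have hΦt : 0 ≤ Φ t := by
    have := hnn t (hs.trans hst)
    positivity
  have hΦs : Φ s ≤ (D * C + a T * Real.exp (T / C)) * Real.exp (-(s / (2 * C))) := by
    have h1 := exp_mul_le_of_hasDerivAt hC ha hle hs
    have h2 : Real.exp (s / (2 * C)) = Real.exp (s / C) * Real.exp (-(s / (2 * C))) := by
      rw [← Real.exp_add]
      congr 1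
      field_simp
      ring
    have h3 : a s * Real.exp (s / (2 * C)) ≤ a T * Real.exp (T / C) * Real.exp (-(s / (2 * C))) := by
      rw [h2, ← mul_assoc]
      gcongr
    simp only [Φ]
    linarith
  have h1 := hmono 1 (by simp)
  have h2 := hmono (-1) (by simp)
  rw [abs_le]
  constructor <;> linarith

end Decay

/-! ### Dominated convergence in `L²` -/

section L2

theorem memLp_exp_neg_mul_abs {μ : ℝ} (hμ : 0 < μ) :
    MemLp (fun s : ℝ => Real.exp (-μ * |s|)) 2 volume := by
  rw [memLp_two_iff_integrable_sq (by fun_prop)]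
  have hsq : ∀ s : ℝ, Real.exp (-μ * |s|) ^ 2 = Real.exp (-(2 * μ) * |s|) := fun s => by
    rw [← Real.exp_nat_mul]
    congr 1
    push_cast
    ring
  simp only [hsq]
  rw [← integrableOn_univ, ← Iic_union_Ioi (a := (0 : ℝ))]
  refine IntegrableOn.union ?_ ?_
  · refine (integrableOn_exp_mul_Iic (a := 2 * μ) (by positivity) 0).congr_fun (fun s hs => ?_)
      measurableSet_Iic
    simp only [abs_of_nonpos (mem_Iic.1 hs), neg_mul_neg]
  · refine (integrableOn_exp_mul_Ioi (a := -(2 * μ)) (by linarith) 0).congr_fun (fun s hs => ?_)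
      measurableSet_Ioi
    simp only [abs_of_pos (mem_Ioi.1 hs)]

theorem memLp_of_abs_le_exp {f : ℝ → ℝ} (hf : AEStronglyMeasurable f) {A μ : ℝ} (hμ : 0 < μ)
    (h : ∀ s, |f s| ≤ A * Real.exp (-μ * |s|)) : MemLp f 2 volume :=
  ((memLp_exp_neg_mul_abs hμ).const_mul A).mono hf (ae_of_all _ fun s => by
    rw [Real.norm_eq_abs]
    exact (h s).trans (le_abs_self _))

/-- Dominated convergence in `L²`. -/
theorem tendsto_eLpNorm_two_of_dominated {α : Type*} [MeasurableSpace α] {μ : Measure α}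
    {f : ℕ → α → ℝ} {f₀ b : α → ℝ}
    (hf : ∀ j, AEStronglyMeasurable (f j) μ) (hf₀ : AEStronglyMeasurable f₀ μ) (hb : MemLp b 2 μ)
    (hle : ∀ j s, |f j s| ≤ b s) (hlim : ∀ s, Tendsto (fun j => f j s) atTop (𝓝 (f₀ s))) :
    Tendsto (fun j => eLpNorm (f j - f₀) 2 μ) atTop (𝓝 0) := by
  have hle₀ : ∀ s, |f₀ s| ≤ b s := fun s => le_of_tendsto (hlim s).abs (Eventually.of_forall (hle · s))
  have hb2 : ∫⁻ s, ‖2 * b s‖ₑ ^ (2 : ℝ) ∂μ ≠ ⊤ := by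
    have := ((hb.const_mul 2).2)
    rw [eLpNorm_lt_top_iff_lintegral_rpow_enorm_lt_top (by simp) (by simp)] at this
    simpa using this.ne
  have key : Tendsto (fun j => ∫⁻ s, ‖(f j - f₀) s‖ₑ ^ (2 : ℝ) ∂μ) atTop
      (𝓝 (∫⁻ _, 0 ∂μ)) := by
    refine tendsto_lintegral_of_dominated_convergence' _
      (fun j => (((hf j).sub hf₀).enorm.pow_const _)) (fun j => ae_of_all _ fun s => ?_) hb2
      (ae_of_all _ fun s => ?_)
    · refine ENNReal.rpow_le_rpow (enorm_le_iff_norm_le.2 ?_) (by norm_num)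
      rw [Pi.sub_apply, Real.norm_eq_abs, Real.norm_eq_abs]
      refine (abs_sub _ _).trans ?_
      have := le_abs_self (2 * b s)
      linarith [hle j s, hle₀ s]
    · have h1 : Tendsto (fun j => ‖(f j - f₀) s‖ₑ) atTop (𝓝 0) := by
        have h2 := ((hlim s).sub_const (f₀ s)).enorm
        simpa using h2
      have := (ENNReal.continuous_rpow_const (y := 2)).tendsto 0 |>.comp h1
      simpa [Function.comp_def] using this
  have h3 := (ENNReal.continuous_rpow_const (y := 1 / 2)).tendsto _ |>.comp key
  simp only [lintegral_zero] at h3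
  rw [ENNReal.zero_rpow_of_pos (by norm_num)] at h3
  refine h3.congr fun j => ?_
  rw [eLpNorm_eq_lintegral_rpow_enorm_toReal (by simp) (by simp)]
  simp

end L2

/-! ### Gradient lines tested on smooth functions -/

section FlowLines

variable {n : ℕ} {M : Type*} [TopologicalSpace M] [ChartedSpace (EuclideanSpace ℝ (Fin n)) M]

theorem hasDerivAt_comp_velocity {f : M → ℝ} (hf : ContMDiff (𝓡 n) 𝓘(ℝ, ℝ) ∞ f) {γ : ℝ → M}
    (hγ : ContMDiff 𝓘(ℝ, ℝ) (𝓡 n) ∞ γ) (s : ℝ) :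
    HasDerivAt (fun t => f (γ t)) (differential n f (γ s) (velocity n γ s)) s := by
  have h1 := (hf.mdifferentiable (by simp) (γ s)).hasMFDerivAt
  have h2 := (hγ.mdifferentiable (by simp) s).hasMFDerivAt
  have h3 : HasFDerivAt (fun t => f (γ t))
      ((differential n f (γ s) : EuclideanSpace ℝ (Fin n) →L[ℝ] ℝ).comp
        (mfderiv 𝓘(ℝ, ℝ) (𝓡 n) γ s : ℝ →L[ℝ] EuclideanSpace ℝ (Fin n))) s :=
    hasMFDerivAt_iff_hasFDerivAt.1 (h1.comp s h2)
  exact h3.hasDerivAt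

theorem TendstoSmoothLoc.tendsto {u : ℕ → ℝ → M} {η : ℝ → M} (h : TendstoSmoothLoc n u η) (s : ℝ) :
    Tendsto (fun j => u j s) atTop (𝓝 (η s)) := by
  obtain ⟨U, -, hsU, -, hu, hlim⟩ := h.2 s
  have h0 := (hlim 0).tendsto_at hsU
  simp only [iteratedDeriv_zero, Function.comp_apply] at h0
  have h1 := (continuousAt_extChartAt_symm (I := 𝓡 n) (η s)).tendsto.comp h0
  rw [extChartAt_to_inv] at h1
  refine h1.congr' ?_
  filter_upwards [hu] with j hj
  exact (extChartAt (𝓡 n) (η s)).left_inv (hj hsU)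

theorem differentiableAt_extChartAt_comp [IsManifold (𝓡 n) ∞ M] {γ : ℝ → M}
    (hγ : ContMDiff 𝓘(ℝ, ℝ) (𝓡 n) ∞ γ) {x₀ : M} {s : ℝ}
    (hs : γ s ∈ (extChartAt (𝓡 n) x₀).source) :
    DifferentiableAt ℝ (extChartAt (𝓡 n) x₀ ∘ γ) s := by
  have h1 := mdifferentiableAt_extChartAt (I := 𝓡 n) (x := x₀) (y := γ s) (by simpa using hs)
  exact (h1.comp s (hγ.mdifferentiable (by simp) s)).differentiableAt

/-- By the chain rule in the chart at `η s`, convergence of the derivatives of orders `0` and `1`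
suffices. -/
theorem TendstoSmoothLoc.tendsto_deriv [IsManifold (𝓡 n) ∞ M] {u : ℕ → ℝ → M} {η : ℝ → M}
    (h : TendstoSmoothLoc n u η) (hu : ∀ j, ContMDiff 𝓘(ℝ, ℝ) (𝓡 n) ∞ (u j)) {f : M → ℝ}
    (hf : ContMDiff (𝓡 n) 𝓘(ℝ, ℝ) ∞ f) (s : ℝ) :
    Tendsto (fun j => deriv (fun t => f (u j t)) s) atTop (𝓝 (deriv (fun t => f (η t)) s)) := by
  obtain ⟨U, hU, hsU, hηU, huU, hlim⟩ := h.2 s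
  have key : ∀ v : ℝ → M, ContMDiff 𝓘(ℝ, ℝ) (𝓡 n) ∞ v →
      MapsTo v U (extChartAt (𝓡 n) (η s)).source →
      deriv (fun t => f (v t)) s =
        fderiv ℝ (f ∘ (extChartAt (𝓡 n) (η s)).symm) (extChartAt (𝓡 n) (η s) (v s))
          (deriv (extChartAt (𝓡 n) (η s) ∘ v) s) := by
    intro v hv hvU
    have h1 := ((contDiffAt_comp_extChartAt_symm hf (hvU hsU)).differentiableAt
      (by simp)).hasFDerivAt
    have h2 := (differentiableAt_extChartAt_comp hv (hvU hsU)).hasDerivAt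
    rw [← (h1.comp_hasDerivAt s h2).deriv]
    refine Filter.EventuallyEq.deriv_eq ?_
    filter_upwards [hU.mem_nhds hsU] with t ht
    simp only [Function.comp_apply, (extChartAt (𝓡 n) (η s)).left_inv (hvU ht)]
  have h0 := (hlim 0).tendsto_at hsU
  have h1 := (hlim 1).tendsto_at hsU
  simp only [iteratedDeriv_zero, iteratedDeriv_one, Function.comp_apply] at h0 h1
  rw [key η h.1 hηU]
  have hc : Tendsto (fderiv ℝ (f ∘ (extChartAt (𝓡 n) (η s)).symm))
      (𝓝 (extChartAt (𝓡 n) (η s) (η s))) (𝓝 _) :=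
    ((contDiffAt_comp_extChartAt_symm hf (hηU hsU)).fderiv_right (m := ∞)
      (by simp)).continuousAt.tendsto
  refine ((isBoundedBilinearMap_apply.continuous.tendsto _).comp
    ((hc.comp h0).prodMk_nhds h1)).congr' ?_
  filter_upwards [huU] with j hj
  exact (key (u j) (hu j) hj).symm

theorem differential_interpolation {β : ℝ → ℝ → ℝ} {h F : M → ℝ}
    (hF : ContMDiff (𝓡 n) 𝓘(ℝ, ℝ) ∞ F) (hh : ContMDiff (𝓡 n) 𝓘(ℝ, ℝ) ∞ h) (r s : ℝ) (x : M)
    (v : TangentSpace (𝓡 n) x) :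
    differential n (interpolation β h F r s) x v =
      β r s * differential n h x v + (1 - β r s) * differential n F x v := by
  have h1 := (hh.mdifferentiable (by simp) x).hasMFDerivAt.const_smul (β r s)
  have h2 := (hF.mdifferentiable (by simp) x).hasMFDerivAt.const_smul (1 - β r s)
  have h3 := (h1.add h2).mfderiv
  have h4 : differential n (interpolation β h F r s) x =
    mfderiv (𝓡 n) 𝓘(ℝ, ℝ) (β r s • h + (1 - β r s) • F) x := rfl
  rw [h4, h3]
  rfl

variable [IsManifold (𝓡 n) ∞ M]

/-- The pairing `g(∇f, ∇h)` of the gradients of two functions. -/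
noncomputable def pairing (g : Metric n M) (f h : M → ℝ) (x : M) : ℝ :=
  differential n f x (gradient g h x)

theorem contMDiff_pairing (g : Metric n M) {f h : M → ℝ}
    (hf : ContMDiff (𝓡 n) 𝓘(ℝ, ℝ) ∞ f) (hh : ContMDiff (𝓡 n) 𝓘(ℝ, ℝ) ∞ h) :
    ContMDiff (𝓡 n) 𝓘(ℝ, ℝ) ∞ (pairing g f h) :=
  contMDiff_differential_gradient g hf hh

theorem pairing_comm (g : Metric n M) (f h : M → ℝ) (x : M) : pairing g f h x = pairing g h f x := by
  rw [pairing, pairing, ← inner_gradient g, ← inner_gradient g, g.symm]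

theorem pairing_self_nonneg (g : Metric n M) (f : M → ℝ) (x : M) : 0 ≤ pairing g f f x :=
  differential_gradient_self_nonneg g f x

theorem pairing_sq_le (g : Metric n M) (f h : M → ℝ) (x : M) :
    pairing g f h x ^ 2 ≤ pairing g f f x * pairing g h h x := by
  have := differential_sq_le g f x (gradient g h x)
  rwa [inner_gradient] at this

theorem pairing_eq_zero_of_mem_criticalSet (g : Metric n M) {f : M → ℝ} (h : M → ℝ) {x : M}
    (hx : x ∈ criticalSet n f) : pairing g f h x = 0 := by
  rw [pairing, show differential n f x = 0 from hx]
  rfl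

variable (g : Metric n M) (β : ℝ → ℝ → ℝ) (h F : M → ℝ)

/-- Minus the rate of change at time `s` of `f` along a gradient line of `G_{r,s}`. -/
noncomputable def flowRate (r s : ℝ) (f : M → ℝ) (x : M) : ℝ :=
  β r s * pairing g h f x + (1 - β r s) * pairing g F f x

/-- Gradient lines of `G_{r,s}`. -/
structure IsFlowLine (r : ℝ) (γ : ℝ → M) : Prop where
  smooth : ContMDiff 𝓘(ℝ, ℝ) (𝓡 n) ∞ γ
  eq_zero : ∀ s, velocity n γ s + gradient g (interpolation β h F r s) (γ s) = 0

variable {g β h F}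

theorem mem_moduliSpace_iff {p : ℝ × (ℝ → M)} : p ∈ moduliSpace g β h F ↔
    0 ≤ p.1 ∧ IsFlowLine g β h F p.1 p.2 ∧ energy g p.2 < ⊤ :=
  ⟨fun ⟨h1, h2, h3, h4⟩ => ⟨h1, ⟨h2, h3⟩, h4⟩, fun ⟨h1, h2, h3⟩ => ⟨h1, h2.1, h2.2, h3⟩⟩

theorem pairing_interpolation (hF : ContMDiff (𝓡 n) 𝓘(ℝ, ℝ) ∞ F)
    (hh : ContMDiff (𝓡 n) 𝓘(ℝ, ℝ) ∞ h) (r s : ℝ) (f : M → ℝ) (x : M) :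
    pairing g f (interpolation β h F r s) x = flowRate g β h F r s f x := by
  rw [pairing_comm, pairing, differential_interpolation hF hh]
  rfl

theorem IsFlowLine.hasDerivAt {r : ℝ} {γ : ℝ → M} (hγ : IsFlowLine g β h F r γ)
    (hF : ContMDiff (𝓡 n) 𝓘(ℝ, ℝ) ∞ F) (hh : ContMDiff (𝓡 n) 𝓘(ℝ, ℝ) ∞ h) {f : M → ℝ}
    (hf : ContMDiff (𝓡 n) 𝓘(ℝ, ℝ) ∞ f) (s : ℝ) :
    HasDerivAt (fun t => f (γ t)) (-flowRate g β h F r s f (γ s)) s := by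
  have h1 := hasDerivAt_comp_velocity hf hγ.smooth s
  rw [eq_neg_of_add_eq_zero_left (hγ.eq_zero s), map_neg] at h1
  rwa [← pairing_interpolation hF hh]

/-- Since `γ' = -∇G_{r,s}`, the energy density is `dG(∇G)`, expanded bilinearly into pairings of `h`
and `F`. In this form its continuity is visible. -/
theorem IsFlowLine.inner_velocity {r : ℝ} {γ : ℝ → M} (hγ : IsFlowLine g β h F r γ)
    (hF : ContMDiff (𝓡 n) 𝓘(ℝ, ℝ) ∞ F) (hh : ContMDiff (𝓡 n) 𝓘(ℝ, ℝ) ∞ h) (s : ℝ) :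
    g.inner (γ s) (velocity n γ s) (velocity n γ s) =
      β r s * flowRate g β h F r s h (γ s) + (1 - β r s) * flowRate g β h F r s F (γ s) := by
  rw [eq_neg_of_add_eq_zero_left (hγ.eq_zero s)]
  simp only [map_neg, neg_apply, neg_neg]
  rw [inner_gradient, differential_interpolation hF hh, ← pairing_interpolation hF hh,
    ← pairing_interpolation hF hh]
  rfl

/-- For each smooth `f` both sides of `(f ∘ γ)' = -g(∇G, ∇f)` pass to the limit, and such `f`
separate tangent vectors. The hypothesis `hβ` covers two cases: no shift with `r j → r₀`, and shifts
that carry the cut-off away, where the limit is a gradient line of `F`. -/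
theorem IsFlowLine.of_tendsto [T2Space M] (hF : ContMDiff (𝓡 n) 𝓘(ℝ, ℝ) ∞ F)
    (hh : ContMDiff (𝓡 n) 𝓘(ℝ, ℝ) ∞ h) {r σ : ℕ → ℝ} {γ : ℕ → ℝ → M} {r₀ : ℝ} {η : ℝ → M}
    (hγ : ∀ j, IsFlowLine g β h F (r j) (γ j))
    (hlim : TendstoSmoothLoc n (fun j t => γ j (t - σ j)) η)
    (hβ : ∀ s, Tendsto (fun j => β (r j) (s - σ j)) atTop (𝓝 (β r₀ s))) :
    IsFlowLine g β h F r₀ η := by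
  refine ⟨hlim.1, fun s => eq_zero_of_forall_differential_eq_zero fun f hf => ?_⟩
  have hsm : ∀ j, ContMDiff 𝓘(ℝ, ℝ) (𝓡 n) ∞ (fun t => γ j (t - σ j)) := fun j =>
    (hγ j).smooth.comp (contMDiff_iff_contDiff.2 (contDiff_id.sub contDiff_const))
  have hd : ∀ j, deriv (fun t => f (γ j (t - σ j))) s =
      -flowRate g β h F (r j) (s - σ j) f (γ j (s - σ j)) := fun j =>
    (((hγ j).hasDerivAt hF hh hf (s - σ j)).comp_sub_const s (σ j)).deriv
  have h1 := hlim.tendsto_deriv hsm hf s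
  simp only [hd] at h1
  have hp : ∀ f' : M → ℝ, ContMDiff (𝓡 n) 𝓘(ℝ, ℝ) ∞ f' →
      Tendsto (fun j => pairing g f' f (γ j (s - σ j))) atTop (𝓝 (pairing g f' f (η s))) :=
    fun f' hf' => ((contMDiff_pairing g hf' hf).continuous.tendsto _).comp (hlim.tendsto s)
  have h2 : Tendsto (fun j => -flowRate g β h F (r j) (s - σ j) f (γ j (s - σ j))) atTop
      (𝓝 (-flowRate g β h F r₀ s f (η s))) :=
    (((hβ s).mul (hp h hh)).add (((hβ s).const_sub 1).mul (hp F hF))).neg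
  have h3 := tendsto_nhds_unique h1 h2
  rw [map_add, ← (hasDerivAt_comp_velocity hf hlim.1 s).deriv, h3, ← pairing_interpolation hF hh,
    pairing, neg_add_cancel]

/-- This replaces compactness of `M`. If `|w|` exceeded `j` at time `s j` on some line, the lines
recentred at these times would have a subsequence converging at time `0`, contradicting continuity
of `w`. -/
theorem SmoothLocCompactness.exists_abs_le (hcpt : SmoothLocCompactness g β h F) {w : M → ℝ}
    (hw : Continuous w) :
    ∃ B : ℝ, 0 ≤ B ∧ ∀ p ∈ moduliSpace g β h F, ∀ s, |w (p.2 s)| ≤ B := by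
  by_contra! hcon
  choose p hp s hs using fun j : ℕ => hcon j j.cast_nonneg
  obtain ⟨φ, hφ, η, hη⟩ := hcpt (fun j => (p j).1) (fun j => (p j).2) (fun j => -s j) hp
  have h1 := ((hw.tendsto _).comp (hη.tendsto 0)).abs
  simp only [Function.comp_def, zero_sub, neg_neg] at h1
  have h2 : Tendsto (fun j => ((φ j : ℕ) : ℝ)) atTop atTop :=
    tendsto_natCast_atTop_atTop.comp hφ.tendsto_atTop
  exact not_tendsto_nhds_of_tendsto_atTop (tendsto_atTop_mono (fun j => (hs (φ j)).le) h2) _ h1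

end FlowLines

/-! ### Properties of the cut-off family -/

section Cutoff

variable {k : ℕ} {bPlus bMinus : ℝ → ℝ} {β : ℝ → ℝ → ℝ}

theorem IsCutoffFamily.contDiff (hβ : IsCutoffFamily k bPlus bMinus β) {r : ℝ} (hr : 0 ≤ r) :
    ContDiff ℝ ∞ (β r) := by
  have : ContDiffOn ℝ ∞ (fun s : ℝ => β (r, s).1 (r, s).2) univ :=
    hβ.smooth.comp (f := fun s : ℝ => (r, s)) (by fun_prop) fun s _ => ⟨hr, mem_univ _⟩
  exact contDiffOn_univ.1 this

theorem IsCutoffFamily.tendsto (hβ : IsCutoffFamily k bPlus bMinus β) {α : Type*} {l : Filter α}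
    {r : α → ℝ} {r₀ : ℝ} (hr : ∀ j, 0 ≤ r j) (hr₀ : 0 ≤ r₀) (hlim : Tendsto r l (𝓝 r₀)) (s : ℝ) :
    Tendsto (fun j => β (r j) s) l (𝓝 (β r₀ s)) := by
  have h1 := hβ.smooth.continuousOn (r₀, s) ⟨hr₀, mem_univ _⟩
  exact h1.tendsto.comp (tendsto_nhdsWithin_iff.2 ⟨hlim.prodMk_nhds tendsto_const_nhds,
    Eventually.of_forall fun j => ⟨hr j, mem_univ _⟩⟩)

/-- By continuity at `r = 0`. Hence gradient lines of `F` of finite energy belong to the moduli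
space with parameter `0`, and the compactness assumption applies to them. -/
theorem IsCutoffFamily.zero (hβ : IsCutoffFamily k bPlus bMinus β) (s : ℝ) : β 0 s = 0 := by
  have h1 := (hβ.tendsto_zero 0).tendsto_at s
  simp only [iteratedDeriv_zero, Pi.zero_apply] at h1
  have h2 : Tendsto (fun r => β r s) (𝓝[>] 0) (𝓝 (β 0 s)) := by
    have h3 := hβ.smooth.continuousOn (0, s) ⟨mem_Ici.2 le_rfl, mem_univ _⟩
    refine h3.tendsto.comp (f := fun r : ℝ => (r, s)) (tendsto_nhdsWithin_iff.2
      ⟨(tendsto_nhdsWithin_of_tendsto_nhds tendsto_id).prodMk_nhds tendsto_const_nhds, ?_⟩)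
    filter_upwards [self_mem_nhdsWithin] with r hr
    exact ⟨mem_Ici.2 (le_of_lt hr), mem_univ _⟩
  exact tendsto_nhds_unique h2 h1

theorem IsCutoffFamily.eq_zero_of_le_abs (hβ : IsCutoffFamily k bPlus bMinus β) {r R s : ℝ}
    (hr : r ∈ Icc 0 R) (hs : ((k : ℝ) + 1) * R + 1 ≤ |s|) : β r s = 0 := by
  have hk : ((k : ℝ) + 1) * r ≤ (k + 1) * R := mul_le_mul_of_nonneg_left hr.2 (by positivity)
  have hk0 : 0 ≤ ((k : ℝ) + 1) * r := mul_nonneg (by positivity) hr.1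
  refine hβ.eq_zero r hr.1 s ?_
  rcases le_total 0 s with h0 | h0
  · rw [abs_of_nonneg h0] at hs
    exact Or.inr (by linarith)
  · rw [abs_of_nonpos h0] at hs
    exact Or.inl (by linarith)

theorem IsCutoffFamily.deriv_eq_zero (hβ : IsCutoffFamily k bPlus bMinus β) {r : ℝ} (hr : 0 ≤ r)
    {s : ℝ} (hs : s ∈ Ioo 0 (((k : ℝ) + 1) * r)) : deriv (β r) s = 0 := by
  rcases le_total r 1 with h1 | h1
  · exact hβ.deriv_plateau r hr h1 s (Ioo_subset_Icc_self hs)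
  · have : β r =ᶠ[𝓝 s] fun _ => 1 := by
      filter_upwards [Ioo_mem_nhds hs.1 hs.2] with t ht
      exact hβ.eq_one r h1 t (Ioo_subset_Icc_self ht)
    rw [this.deriv_eq, deriv_const]

end Cutoff

/-- An oscillation below `S ≤ ∞` is finite, which forces the supremum and the infimum to be real. -/
theorem exists_bounds_of_oscillation_lt {M : Type*} [Nonempty M] {f : M → ℝ} {S : EReal}
    (h : oscillation f < S) :
    ∃ m K : ℝ, (∀ x, m ≤ f x ∧ f x ≤ K) ∧ ((K - m : ℝ) : EReal) < S := by
  obtain ⟨x₀⟩ := ‹Nonempty M›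
  set I : EReal := ⨅ x, ((f x : ℝ) : EReal)
  set K : EReal := ⨆ x, ((f x : ℝ) : EReal)
  have hI : ∀ x, I ≤ f x := fun x => iInf_le _ x
  have hK : ∀ x, (f x : EReal) ≤ K := fun x => le_iSup (fun x => ((f x : ℝ) : EReal)) x
  have hI1 : I ≠ ⊤ := fun h0 => by
    have := hI x₀
    rw [h0] at this
    simp at this
  have hK1 : K ≠ ⊥ := fun h0 => by
    have := hK x₀
    rw [h0] at this
    simp at this
  have hlt : K - I < ⊤ := lt_of_lt_of_le h le_top
  have hK2 : K ≠ ⊤ := fun h0 => by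
    rw [h0, EReal.top_sub hI1] at hlt
    exact lt_irrefl _ hlt
  have hI2 : I ≠ ⊥ := fun h0 => by
    rw [h0, sub_eq_add_neg, EReal.neg_bot, EReal.add_top_of_ne_bot hK1] at hlt
    exact lt_irrefl _ hlt
  refine ⟨I.toReal, K.toReal, fun x => ⟨?_, ?_⟩, ?_⟩
  · rw [← EReal.coe_le_coe_iff, EReal.coe_toReal hI1 hI2]
    exact hI x
  · rw [← EReal.coe_le_coe_iff, EReal.coe_toReal hK2 hK1]
    exact hK x
  · rw [EReal.coe_sub, EReal.coe_toReal hI1 hI2, EReal.coe_toReal hK2 hK1]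
    exact h

/-! ### Action and energy estimates -/

section Action

variable {n : ℕ} {M : Type*} [TopologicalSpace M] [ChartedSpace (EuclideanSpace ℝ (Fin n)) M]
  [IsManifold (𝓡 n) ∞ M] {g : Metric n M} {β : ℝ → ℝ → ℝ} {h F : M → ℝ} {k : ℕ}
  {bPlus bMinus : ℝ → ℝ} {r : ℝ} {γ : ℝ → M}

theorem IsFlowLine.inner_velocity_nonneg (hγ : IsFlowLine g β h F r γ)
    (hF : ContMDiff (𝓡 n) 𝓘(ℝ, ℝ) ∞ F) (hh : ContMDiff (𝓡 n) 𝓘(ℝ, ℝ) ∞ h) (s : ℝ) :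
    0 ≤ β r s * flowRate g β h F r s h (γ s) + (1 - β r s) * flowRate g β h F r s F (γ s) := by
  rw [← hγ.inner_velocity hF hh]
  rcases eq_or_ne (velocity n γ s) 0 with hu | hu
  · rw [hu]
    simp
  · exact (g.pos _ _ hu).le

theorem flowRate_of_eq_zero {s : ℝ} (hs : β r s = 0) (f : M → ℝ) (x : M) :
    flowRate g β h F r s f x = pairing g F f x := by
  simp [flowRate, hs]

theorem IsFlowLine.hasDerivAt_of_eq_zero (hγ : IsFlowLine g β h F r γ)
    (hF : ContMDiff (𝓡 n) 𝓘(ℝ, ℝ) ∞ F) (hh : ContMDiff (𝓡 n) 𝓘(ℝ, ℝ) ∞ h) {f : M → ℝ}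
    (hf : ContMDiff (𝓡 n) 𝓘(ℝ, ℝ) ∞ f) {s : ℝ} (hs : β r s = 0) :
    HasDerivAt (fun t => f (γ t)) (-pairing g F f (γ s)) s := by
  have := hγ.hasDerivAt hF hh hf s
  rwa [flowRate_of_eq_zero hs] at this

theorem IsFlowLine.antitoneOn (hγ : IsFlowLine g β h F r γ)
    (hF : ContMDiff (𝓡 n) 𝓘(ℝ, ℝ) ∞ F) (hh : ContMDiff (𝓡 n) 𝓘(ℝ, ℝ) ∞ h) {D : Set ℝ}
    (hD : Convex ℝ D) (hs : ∀ s ∈ D, β r s = 0) : AntitoneOn (fun t => F (γ t)) D := by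
  have hd := fun s hsD => hγ.hasDerivAt_of_eq_zero hF hh hF (hs s hsD)
  refine antitoneOn_of_deriv_nonpos hD (fun s hs => (hd s hs).continuousAt.continuousWithinAt)
    (fun s hs => (hd s (interior_subset hs)).differentiableAt.differentiableWithinAt)
    fun s hs => ?_
  rw [(hd s (interior_subset hs)).deriv]
  exact neg_nonpos.2 (pairing_self_nonneg g F _)

/-- The action estimate: on its ends, the function `F` is bounded along a gradient line from `Z` to
`Z` by the oscillation of `h - F`. -/
theorem IsFlowLine.abs_le_of_tendsto (hγ : IsFlowLine g β h F r γ) (hβ : IsCutoffFamily k bPlus bMinus β)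
    (hr : 0 ≤ r) (hF : ContMDiff (𝓡 n) 𝓘(ℝ, ℝ) ∞ F) (hh : ContMDiff (𝓡 n) 𝓘(ℝ, ℝ) ∞ h)
    {m K : ℝ} (hb : ∀ x, m ≤ h x - F x ∧ h x - F x ≤ K)
    (htop : Tendsto (fun s => F (γ s)) atTop (𝓝 0)) (hbot : Tendsto (fun s => F (γ s)) atBot (𝓝 0))
    {s : ℝ} (hs : s ≤ -1 ∨ ((k : ℝ) + 1) * r + 1 ≤ s) : |F (γ s)| ≤ K - m := by
  set ℓ : ℝ := ((k : ℝ) + 1) * r with hℓ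
  have hℓ0 : 0 ≤ ℓ := mul_nonneg (by positivity) hr
  have hKm : 0 ≤ K - m := by linarith [hb (γ 0)]
  -- This function is `G_{r,s}(γ s) - c β_r(s)`, with derivative `β_r' (h - F - c) - |γ'|²`.
  have hd : ∀ c s, HasDerivAt (fun s => F (γ s) + β r s * (h (γ s) - F (γ s)) - c * β r s)
      (deriv (β r) s * (h (γ s) - F (γ s) - c) - (β r s * flowRate g β h F r s h (γ s) +
        (1 - β r s) * flowRate g β h F r s F (γ s))) s := by
    intro c s
    have h1 : HasDerivAt (β r) (deriv (β r) s) s :=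
      ((hβ.contDiff hr).differentiable (by simp) s).hasDerivAt
    have h2 := hγ.hasDerivAt hF hh hF s
    have h3 := hγ.hasDerivAt hF hh hh s
    refine ((h2.add (h1.mul (h3.sub h2))).sub (h1.const_mul c)).congr_deriv ?_
    simp only [Pi.sub_apply]
    ring
  have hanti : ∀ c a b : ℝ, a ≤ b →
      (∀ s ∈ Ioo a b, deriv (β r) s * (h (γ s) - F (γ s) - c) ≤ 0) →
      F (γ b) + β r b * (h (γ b) - F (γ b)) - c * β r b ≤
        F (γ a) + β r a * (h (γ a) - F (γ a)) - c * β r a := by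
    intro c a b hab hle
    refine antitoneOn_of_deriv_nonpos (convex_Icc a b)
      (fun s hs => (hd c s).continuousAt.continuousWithinAt)
      (fun s hs => (hd c s).differentiableAt.differentiableWithinAt)
      (fun s hs => ?_) (left_mem_Icc.2 hab) (right_mem_Icc.2 hab) hab
    rw [interior_Icc] at hs
    rw [(hd c s).deriv]
    linarith [hle s hs, hγ.inner_velocity_nonneg hF hh s]
  -- The constant `c` is chosen to make `β_r' (h - F - c) ≤ 0`: the upper bound `K` where `β_r`
  -- rises, the lower bound `m` where it falls. Changing `c` at `ℓ` costs `(K - m) β_r(ℓ) ≤ K - m`.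
  have h1 := hanti K (-1) 0 (by norm_num) fun s hs => mul_nonpos_of_nonneg_of_nonpos
    (hβ.deriv_left r hr s hs).1 (by linarith [hb (γ s)])
  have h2 := hanti K 0 ℓ hℓ0 fun s hs => by rw [hβ.deriv_eq_zero hr hs, zero_mul]
  have h3 := hanti m ℓ (ℓ + 1) (by linarith) fun s hs => mul_nonpos_of_nonpos_of_nonneg
    (hβ.deriv_right r hr s hs).1 (by linarith [hb (γ s)])
  rw [hβ.eq_zero r hr (-1) (Or.inl le_rfl)] at h1
  rw [hβ.eq_zero r hr (ℓ + 1) (Or.inr le_rfl)] at h3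
  have h4 : F (γ (ℓ + 1)) ≤ F (γ (-1)) + (K - m) := by
    have h5 : (K - m) * β r ℓ ≤ K - m := mul_le_of_le_one_right hKm (hβ.mem_Icc r hr ℓ).2
    linarith
  have hleft := hγ.antitoneOn hF hh (convex_Iic (-1)) fun s hs => hβ.eq_zero r hr s (Or.inl hs)
  have hright := hγ.antitoneOn hF hh (convex_Ici (ℓ + 1)) fun s hs => hβ.eq_zero r hr s (Or.inr hs)
  -- On both ends `F` decreases, from `0` on the left and towards `0` on the right. These signs turn
  -- the one-sided estimate `h4` into bounds on `|F|`.
  have hneg : ∀ s ≤ -1, F (γ s) ≤ 0 := fun s hs => ge_of_tendsto hbot <| by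
    filter_upwards [eventually_le_atBot s] with t ht
    exact hleft (ht.trans hs) hs ht
  have hpos : ∀ s, ℓ + 1 ≤ s → 0 ≤ F (γ s) := fun s hs => le_of_tendsto htop <| by
    filter_upwards [eventually_ge_atTop s] with t ht
    exact hright hs (hs.trans ht) ht
  have h6 := hneg (-1) le_rfl
  have h7 := hpos (ℓ + 1) le_rfl
  rcases hs with hs | hs
  · have h8 : F (γ (-1)) ≤ F (γ s) := hleft hs self_mem_Iic hs
    have h9 := hneg s hs
    rw [abs_of_nonpos h9]
    linarith
  · have h8 : F (γ s) ≤ F (γ (ℓ + 1)) := hright self_mem_Ici hs hs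
    have h9 := hpos s hs
    rw [abs_of_nonneg h9]
    linarith

/-- A gradient line along whose ends `F` is bounded has finite energy. -/
theorem IsFlowLine.energy_lt_top (hγ : IsFlowLine g β h F r γ)
    (hβ : IsCutoffFamily k bPlus bMinus β) (hr : 0 ≤ r) (hF : ContMDiff (𝓡 n) 𝓘(ℝ, ℝ) ∞ F)
    (hh : ContMDiff (𝓡 n) 𝓘(ℝ, ℝ) ∞ h) {b T : ℝ} (hβT : ∀ s, T ≤ |s| → β r s = 0)
    (hb : ∀ s, T ≤ |s| → |F (γ s)| ≤ b) : energy g γ < ⊤ := by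
  set e : ℝ → ℝ := fun s => g.inner (γ s) (velocity n γ s) (velocity n γ s) with he
  have heq : e = fun s => β r s * flowRate g β h F r s h (γ s) +
      (1 - β r s) * flowRate g β h F r s F (γ s) := funext fun s => hγ.inner_velocity hF hh s
  have henn : ∀ s, 0 ≤ e s := fun s => by
    rw [heq]
    exact hγ.inner_velocity_nonneg hF hh s
  have hcont : Continuous e := by
    have hc : ∀ f₁ f₂ : M → ℝ, ContMDiff (𝓡 n) 𝓘(ℝ, ℝ) ∞ f₁ → ContMDiff (𝓡 n) 𝓘(ℝ, ℝ) ∞ f₂ →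
        Continuous fun s => pairing g f₁ f₂ (γ s) := fun f₁ f₂ h₁ h₂ =>
      (contMDiff_pairing g h₁ h₂).continuous.comp hγ.smooth.continuous
    have h1 := (hβ.contDiff hr).continuous
    have h2 := hc h h hh hh
    have h3 := hc F h hF hh
    have h4 := hc h F hh hF
    have h5 := hc F F hF hF
    rw [heq]
    unfold flowRate
    fun_prop
  have htail : ∀ s, T ≤ |s| → HasDerivAt (fun t => -F (γ t)) (e s) s := fun s hs => by
    have h1 := (hγ.hasDerivAt_of_eq_zero hF hh hF (hβT s hs)).neg
    have h2 : e s = - -pairing g F F (γ s) := by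
      rw [heq]
      simp [hβT s hs, flowRate_of_eq_zero]
    rwa [h2]
  refine Integrable.lintegral_lt_top (f := e) ?_
  -- On each end the energy density is the derivative of `-F ∘ γ`, so that end contributes at most
  -- `2 b`.
  refine integrable_of_intervalIntegral_norm_bounded (a := fun i : ℝ => -i) (b := fun i : ℝ => i)
    (l := atTop) (2 * b + (∫ s in -T..T, e s) + 2 * b)
    (fun i => (hcont.integrableOn_Icc).mono_set Ioc_subset_Icc_self) tendsto_neg_atTop_atBot
    tendsto_id ?_
  filter_upwards [eventually_ge_atTop T] with i hi
  simp only [Real.norm_of_nonneg (henn _)]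
  have hii : ∀ a b, IntervalIntegrable e volume a b := fun a b => hcont.intervalIntegrable a b
  rw [← intervalIntegral.integral_add_adjacent_intervals (hii (-i) T) (hii T i),
    ← intervalIntegral.integral_add_adjacent_intervals (hii (-i) (-T)) (hii (-T) T)]
  have h1 : ∫ s in T..i, e s = -F (γ i) - -F (γ T) :=
    intervalIntegral.integral_eq_sub_of_hasDerivAt (fun s hs => htail s (by
      rw [uIcc_of_le hi] at hs
      exact hs.1.trans (le_abs_self s))) (hii _ _)
  have h2 : ∫ s in -i..-T, e s = -F (γ (-T)) - -F (γ (-i)) :=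
    intervalIntegral.integral_eq_sub_of_hasDerivAt (fun s hs => htail s (by
      rw [uIcc_of_le (neg_le_neg hi)] at hs
      exact (le_neg_of_le_neg hs.2).trans (neg_le_abs s))) (hii _ _)
  rw [h1, h2]
  have hbT : T ≤ |T| := le_abs_self T
  have hbT' : T ≤ |-T| := by rwa [abs_neg]
  have hbi : T ≤ |i| := hi.trans (le_abs_self i)
  have hbi' : T ≤ |-i| := by rwa [abs_neg]
  have := abs_le.1 (hb _ hbT)
  have := abs_le.1 (hb _ hbT')
  have := abs_le.1 (hb _ hbi)
  have := abs_le.1 (hb _ hbi')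
  linarith

end Action

/-! ### No breaking below the spectral gap -/

section Compactness

variable {n : ℕ} {M : Type*} [TopologicalSpace M] [T2Space M]
  [ChartedSpace (EuclideanSpace ℝ (Fin n)) M]
  [IsManifold (𝓡 n) ∞ M] {g : Metric n M} {β : ℝ → ℝ → ℝ} {h F : M → ℝ} {k : ℕ}
  {bPlus bMinus : ℝ → ℝ} {Z : Set M} {b R : ℝ}

/-- Gradient lines of `F` along which `|F|` is less than the spectral gap are constant. -/
theorem IsFlowLine.mem_of_abs_le {η : ℝ → M} (hη : IsFlowLine g β h F 0 η)
    (hβ : IsCutoffFamily k bPlus bMinus β) (hF : ContMDiff (𝓡 n) 𝓘(ℝ, ℝ) ∞ F)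
    (hh : ContMDiff (𝓡 n) 𝓘(ℝ, ℝ) ∞ h) (hcpt : SmoothLocCompactness g β h F)
    (hZ : ∀ x ∈ criticalSet n F, |F x| ≤ b → x ∈ Z) (hFZ : ∀ z ∈ Z, F z = 0)
    (hb : ∀ s, |F (η s)| ≤ b) (s : ℝ) : η s ∈ Z := by
  have hb0 : 0 ≤ b := (abs_nonneg _).trans (hb 0)
  have hd : ∀ {ζ : ℝ → M}, IsFlowLine g β h F 0 ζ → ∀ s,
      HasDerivAt (fun t => F (ζ t)) (-pairing g F F (ζ s)) s := fun hζ s =>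
    hζ.hasDerivAt_of_eq_zero hF hh hF (hβ.zero s)
  have hconst : ∀ {ζ : ℝ → M}, IsFlowLine g β h F 0 ζ → ∀ {c : ℝ}, (∀ s, F (ζ s) = c) → ∀ s,
      ζ s ∈ criticalSet n F := fun {ζ} hζ {c} hc s => by
    have h1 := (hd hζ s).unique (by simpa only [hc] using hasDerivAt_const s c)
    exact mem_criticalSet_of_gradient g (neg_eq_zero.1 h1)
  have hmem : (0, η) ∈ moduliSpace g β h F := mem_moduliSpace_iff.2 ⟨le_rfl, hη,
    hη.energy_lt_top (T := 0) hβ le_rfl hF hh (fun s _ => hβ.zero s) fun s _ => hb s⟩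
  -- If `F` tends to `c` along translates of `η`, their limit line has `F` constantly equal to `c`.
  -- It therefore consists of critical points with `|F| ≤ b`, which lie in `Z`.
  have hend : ∀ (σ : ℕ → ℝ) (c : ℝ),
      (∀ t, Tendsto (fun j => F (η (t - σ j))) atTop (𝓝 c)) → c = 0 := by
    intro σ c hc
    obtain ⟨φ, hφ, ζ, hζ⟩ := hcpt (fun _ => 0) (fun _ => η) σ fun _ => hmem
    have hζ' : IsFlowLine g β h F 0 ζ := IsFlowLine.of_tendsto hF hh (r := fun _ => 0)
      (γ := fun _ => η) (σ := fun j => σ (φ j)) (fun _ => hη) hζ fun s => by simp [hβ.zero]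
    have hval : ∀ t, F (ζ t) = c := fun t => tendsto_nhds_unique
      ((hF.continuous.tendsto _).comp (hζ.tendsto t)) ((hc t).comp hφ.tendsto_atTop)
    have hcb : |c| ≤ b := le_of_tendsto (hc 0).abs (Eventually.of_forall fun _ => hb _)
    rw [← hval 0]
    exact hFZ _ (hZ _ (hconst hζ' hval 0) (by rwa [hval]))
  have hanti : Antitone fun t => F (η t) := fun s t hst =>
    hη.antitoneOn hF hh convex_univ (fun s _ => hβ.zero s) (mem_univ _) (mem_univ _) hst
  have htop := tendsto_atTop_ciInf hanti ⟨-b, by rintro _ ⟨t, rfl⟩; exact (abs_le.1 (hb t)).1⟩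
  have hbot := tendsto_atBot_ciSup hanti ⟨b, by rintro _ ⟨t, rfl⟩; exact (abs_le.1 (hb t)).2⟩
  have h1 := hend (fun j => -(j : ℝ)) _ fun t => htop.comp <| by
    simp only [sub_neg_eq_add]
    exact tendsto_atTop_add_const_left _ _ tendsto_natCast_atTop_atTop
  have h2 := hend (fun j => (j : ℝ)) _ fun t => hbot.comp <| by
    simp only [sub_eq_add_neg]
    exact tendsto_atBot_add_const_left _ _ (tendsto_neg_atTop_atBot.comp tendsto_natCast_atTop_atTop)
  rw [h1] at htop
  rw [h2] at hbot
  have hzero : ∀ t, F (η t) = 0 := fun t => le_antisymm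
    (hanti.ge_of_tendsto hbot t) (hanti.le_of_tendsto htop t)
  exact hZ _ (hconst hη hzero s) (by rwa [hzero, abs_zero])

variable (g β h F) in
/-- The gradient lines in the moduli space with parameter in `[0,R]` on whose ends `|F| ≤ b`. -/
def boundedModuli (R T b : ℝ) : Set (ℝ × (ℝ → M)) :=
  {p | p ∈ moduliSpace g β h F ∧ p.1 ∈ Icc 0 R ∧ ∀ s, T ≤ |s| → |F (p.2 s)| ≤ b}

/-- The ends of the gradient lines are uniformly close to `Z`. -/
theorem exists_forall_mem_of_isOpen (hβ : IsCutoffFamily k bPlus bMinus β)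
    (hF : ContMDiff (𝓡 n) 𝓘(ℝ, ℝ) ∞ F)
    (hh : ContMDiff (𝓡 n) 𝓘(ℝ, ℝ) ∞ h) (hcpt : SmoothLocCompactness g β h F)
    (hZ : ∀ x ∈ criticalSet n F, |F x| ≤ b → x ∈ Z) (hFZ : ∀ z ∈ Z, F z = 0) {T : ℝ}
    (hT : ((k : ℝ) + 1) * R + 1 ≤ T) {U : Set M} (hU : IsOpen U) (hZU : Z ⊆ U) :
    ∃ T' : ℝ, ∀ p ∈ boundedModuli g β h F R T b, ∀ s, T' ≤ |s| → p.2 s ∈ U := by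
  by_contra! hcon
  choose p hp s hs hsU using fun j : ℕ => hcon j
  obtain ⟨φ, hφ, η, hη⟩ := hcpt (fun j => (p j).1) (fun j => (p j).2) (fun j => -s j)
    fun j => (hp j).1
  -- After recentring at `s j`, with `|s j| ≥ j`, each fixed time eventually falls on an end, where
  -- the cut-off vanishes and `|F| ≤ b`.
  have hlarge : ∀ t : ℝ, ∀ᶠ j in atTop, T ≤ |t - -s (φ j)| := by
    intro t
    have h1 : Tendsto (fun j => ((φ j : ℕ) : ℝ)) atTop atTop :=
      tendsto_natCast_atTop_atTop.comp hφ.tendsto_atTop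
    filter_upwards [h1.eventually_ge_atTop (T + |t|)] with j hj
    have h2 := hs (φ j)
    have h3 := abs_sub_abs_le_abs_sub (s (φ j)) (-t)
    rw [abs_neg, sub_neg_eq_add, add_comm (s (φ j))] at h3
    rw [sub_neg_eq_add]
    linarith
  have hη' : IsFlowLine g β h F 0 η := IsFlowLine.of_tendsto hF hh (r := fun j => (p (φ j)).1)
    (γ := fun j => (p (φ j)).2) (σ := fun j => -s (φ j))
    (fun j => (mem_moduliSpace_iff.1 (hp (φ j)).1).2.1) hη fun t => by
      refine tendsto_nhds_of_eventually_eq ?_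
      filter_upwards [hlarge t] with j hj
      rw [hβ.zero, hβ.eq_zero_of_le_abs (hp (φ j)).2.1 (hT.trans hj)]
  have hbound : ∀ t, |F (η t)| ≤ b := fun t =>
    le_of_tendsto ((hF.continuous.tendsto _).comp (hη.tendsto t)).abs <| by
      filter_upwards [hlarge t] with j hj
      exact (hp (φ j)).2.2 _ hj
  have h0 := hη'.mem_of_abs_le hβ hF hh hcpt hZ hFZ hbound 0
  obtain ⟨j, hj⟩ := ((hη.tendsto 0).eventually (hU.mem_nhds (hZU h0))).exists
  rw [zero_sub, neg_neg] at hj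
  exact hsU _ hj

end Compactness

/-- Compactness of `Z` yields a cluster point `z ∈ Z`. A bump function at `z` is infinitely often
above `2/3` along `v` and eventually varies by less than `1/3`, so it stays nonzero and `v` stays in
its support. -/
theorem tendsto_of_le_nhdsSet_of_cauchy {n : ℕ} {M : Type*} [TopologicalSpace M] [T2Space M]
    [ChartedSpace (EuclideanSpace ℝ (Fin n)) M] [IsManifold (𝓡 n) ∞ M] {Z : Set M}
    (hZ : IsCompact Z) {v : ℝ → M} (hv : map v atTop ≤ 𝓝ˢ Z)
    (hcau : ∀ f : M → ℝ, ContMDiff (𝓡 n) 𝓘(ℝ, ℝ) ∞ f → ∃ δ : ℝ → ℝ, Tendsto δ atTop (𝓝 0) ∧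
      ∀ᶠ s in atTop, ∀ t, s ≤ t → |f (v t) - f (v s)| ≤ δ s) :
    ∃ z ∈ Z, Tendsto v atTop (𝓝 z) := by
  have hnd : ¬ Disjoint (𝓝ˢ Z) (map v atTop) := fun hd =>
    (map_neBot (f := atTop) (m := v)).ne (disjoint_self.1 (hd.mono_left hv))
  rw [hZ.disjoint_nhdsSet_left] at hnd
  push Not at hnd
  obtain ⟨z, hzZ, hz⟩ := hnd
  refine ⟨z, hzZ, fun V hV => ?_⟩
  obtain ⟨f, hf, hf1, hf0⟩ := exists_contMDiff_support_subset n hV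
  obtain ⟨δ, hδ, hle⟩ := hcau f hf
  have hfreq : ∃ᶠ s in atTop, 2 / 3 < f (v s) := by
    have hW : {x | 2 / 3 < f x} ∈ 𝓝 z :=
      (isOpen_lt continuous_const hf.continuous).mem_nhds (by simp [hf1]; norm_num)
    intro hnot
    exact hz (disjoint_of_disjoint_of_mem disjoint_compl_right hW hnot)
  obtain ⟨s, hs, hs1, hs2⟩ :=
    (hfreq.and_eventually (hle.and (hδ.eventually_lt_const (by norm_num : (0 : ℝ) < 1 / 3)))).exists
  rw [mem_map]
  filter_upwards [eventually_ge_atTop s] with t ht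
  by_contra hout
  have h1 := hs1 t ht
  rw [hf0 _ hout, zero_sub, abs_neg] at h1
  linarith [le_abs_self (f (v s))]

/-! ### Uniform exponential convergence of the ends -/

section Decay

variable {n : ℕ} {M : Type*} [TopologicalSpace M] [T2Space M]
  [ChartedSpace (EuclideanSpace ℝ (Fin n)) M]
  [IsManifold (𝓡 n) ∞ M] {g : Metric n M} {β : ℝ → ℝ → ℝ} {h F : M → ℝ} {k : ℕ}
  {bPlus bMinus : ℝ → ℝ} {Z : Set M} {b R : ℝ}

/-- Uniform exponential decay at both ends; the sign `ε` selects the end. -/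
theorem exists_exponential_decay (hβ : IsCutoffFamily k bPlus bMinus β)
    (hF : ContMDiff (𝓡 n) 𝓘(ℝ, ℝ) ∞ F)
    (hh : ContMDiff (𝓡 n) 𝓘(ℝ, ℝ) ∞ h) (hcpt : SmoothLocCompactness g β h F)
    (hZ : ∀ x ∈ criticalSet n F, |F x| ≤ b → x ∈ Z) (hFZ : ∀ z ∈ Z, F z = 0) {T₀ : ℝ}
    (hT₀ : ((k : ℝ) + 1) * R + 1 ≤ T₀) {C : ℝ} (hC : 0 < C) {U : Set M} (hU : IsOpen U)
    (hZU : Z ⊆ U) (hloj : ∀ x ∈ U, |F x| ≤ C * pairing g F F x) :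
    ∃ T, T₀ ≤ T ∧ 0 ≤ T ∧ ∀ f : M → ℝ, ContMDiff (𝓡 n) 𝓘(ℝ, ℝ) ∞ f → ∃ A : ℝ, 0 ≤ A ∧
      ∀ p ∈ boundedModuli g β h F R T₀ b, ∀ ε : ℝ, |ε| = 1 → ∀ s t, T ≤ s → s ≤ t →
        |f (p.2 (ε * t)) - f (p.2 (ε * s))| ≤ A * Real.exp (-(s / (2 * C))) := by
  obtain ⟨T₁, hT₁⟩ := exists_forall_mem_of_isOpen hβ hF hh hcpt hZ hFZ hT₀ hU hZU
  refine ⟨max (max T₀ T₁) 0, (le_max_left _ _).trans (le_max_left _ _), le_max_right _ _,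
    fun f hf => ?_⟩
  set T := max (max T₀ T₁) 0 with hT
  have hTT₀ : T₀ ≤ T := (le_max_left _ _).trans (le_max_left _ _)
  have hTT₁ : T₁ ≤ T := (le_max_right _ _).trans (le_max_left _ _)
  have hT0 : 0 ≤ T := le_max_right _ _
  -- `D` bounds `|∇f|²` along all lines, so Cauchy-Schwarz gives `((f ∘ γ)')² ≤ D |∇F|²` on the
  -- ends.
  obtain ⟨D, hD, hDle⟩ := hcpt.exists_abs_le (contMDiff_pairing g hf hf).continuous
  refine ⟨max (D * C + b * Real.exp (T / C)) 0, le_max_right _ _,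
    fun p hp ε hε s t hs hst => ?_⟩
  have hflow := (mem_moduliSpace_iff.1 hp.1).2.1
  have habs : ∀ s, T ≤ s → T ≤ |ε * s| := fun s hs => by
    rw [abs_mul, hε, one_mul]
    exact hs.trans (le_abs_self s)
  have hβ0 : ∀ s, T ≤ s → β p.1 (ε * s) = 0 := fun s hs =>
    hβ.eq_zero_of_le_abs hp.2.1 ((hT₀.trans hTT₀).trans (habs s hs))
  have hεε : ε * ε = 1 := by rw [← abs_mul_abs_self, hε, one_mul]
  have hcomp : ∀ (f : M → ℝ), ContMDiff (𝓡 n) 𝓘(ℝ, ℝ) ∞ f → ∀ s, T ≤ s →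
      HasDerivAt (fun t => f (p.2 (ε * t))) (ε * -pairing g F f (p.2 (ε * s))) s := by
    intro f hf s hs
    have h1 := hflow.hasDerivAt_of_eq_zero hF hh hf (hβ0 s hs)
    have h2 : HasDerivAt (fun t => ε * t) ε s := by
      simpa using (hasDerivAt_id s).const_mul ε
    rw [mul_comm ε (-_)]
    exact h1.comp s h2
  -- Reversing time and the sign of `F` together makes both ends look alike: `ε F(γ(ε t))` decreases
  -- to `0`, with dissipation `|∇F|²`.
  have ha : ∀ s, T ≤ s → HasDerivAt (fun t => ε * F (p.2 (ε * t)))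
      (-(pairing g F F (p.2 (ε * s)))) s := fun s hs =>
    ((hcomp F hF s hs).const_mul ε).congr_deriv (by rw [← mul_assoc, hεε, one_mul])
  have hanti : AntitoneOn (fun t => ε * F (p.2 (ε * t))) (Ici T) :=
    antitoneOn_of_deriv_nonpos (convex_Ici T)
      (fun s hs => (ha s hs).continuousAt.continuousWithinAt)
      (fun s hs => (ha s (interior_subset hs)).differentiableAt.differentiableWithinAt)
      fun s hs => by
        rw [(ha s (interior_subset hs)).deriv]
        exact neg_nonpos.2 (pairing_self_nonneg g F _)
  have hlim : Tendsto (fun t => ε * F (p.2 (ε * t))) atTop (𝓝 0) := by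
    rw [Metric.tendsto_atTop]
    intro δ hδ
    obtain ⟨T₂, hT₂⟩ := exists_forall_mem_of_isOpen (U := {x | |F x| < δ}) hβ hF hh hcpt hZ hFZ hT₀
      (isOpen_lt hF.continuous.abs continuous_const) fun z hz => by simpa [hFZ z hz] using hδ
    refine ⟨T₂, fun s hs => ?_⟩
    rw [Real.dist_eq, sub_zero, abs_mul, hε, one_mul]
    exact hT₂ p hp _ (by rw [abs_mul, hε, one_mul]; exact hs.trans (le_abs_self s))
  have hnn : ∀ s, T ≤ s → 0 ≤ ε * F (p.2 (ε * s)) := fun s hs => le_of_tendsto hlim <| by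
    filter_upwards [eventually_ge_atTop s] with t ht
    exact hanti hs (mem_Ici.2 (hs.trans ht)) ht
  have hεF : ∀ s, ε * F (p.2 (ε * s)) ≤ |F (p.2 (ε * s))| := fun s =>
    (le_abs_self _).trans (by rw [abs_mul, hε, one_mul])
  have hle : ∀ s, T ≤ s → ε * F (p.2 (ε * s)) ≤ C * pairing g F F (p.2 (ε * s)) := fun s hs =>
    (hεF s).trans (hloj _ (hT₁ p hp _ (hTT₁.trans (habs s hs))))
  have hsq : ∀ s, T ≤ s → (ε * -pairing g F f (p.2 (ε * s))) ^ 2 ≤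
      D * pairing g F F (p.2 (ε * s)) := fun s _ => by
    have h1 := pairing_sq_le g F f (p.2 (ε * s))
    have h2 := mul_le_mul_of_nonneg_left ((le_abs_self _).trans (hDle p hp.1 (ε * s)))
      (pairing_self_nonneg g F (p.2 (ε * s)))
    rw [mul_pow, sq ε, hεε, one_mul, neg_sq]
    linarith
  refine (abs_sub_le_exp_of_hasDerivAt hC hD ha (hcomp f hf) hnn hle hsq hs hst).trans ?_
  refine mul_le_mul_of_nonneg_right (le_max_of_le_left ?_) (Real.exp_pos _).le
  have hb : ε * F (p.2 (ε * T)) ≤ b := (hεF T).trans (hp.2.2 _ (hTT₀.trans (habs T le_rfl)))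
  gcongr

/-- The analytic setting of the compactness theorem: `F` satisfies a Łojasiewicz inequality near the
compact critical set `Z`, which contains all critical points with `|F| ≤ b`. -/
structure CompactnessSetting (g : Metric n M) (β : ℝ → ℝ → ℝ) (h F : M → ℝ) (k : ℕ)
    (bPlus bMinus : ℝ → ℝ) (Z : Set M) (b C : ℝ) (U : Set M) : Prop where
  cutoff : IsCutoffFamily k bPlus bMinus β
  smooth_F : ContMDiff (𝓡 n) 𝓘(ℝ, ℝ) ∞ F
  smooth_h : ContMDiff (𝓡 n) 𝓘(ℝ, ℝ) ∞ h
  locCompact : SmoothLocCompactness g β h F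
  mem_of_critical : ∀ x ∈ criticalSet n F, |F x| ≤ b → x ∈ Z
  critical : Z ⊆ criticalSet n F
  eq_zero : ∀ z ∈ Z, F z = 0
  isCompact : IsCompact Z
  C_pos : 0 < C
  isOpen : IsOpen U
  subset : Z ⊆ U
  lojasiewicz : ∀ x ∈ U, |F x| ≤ C * pairing g F F x

variable {C : ℝ} {U : Set M}

/-- The ends approach `Z` as a set, and the decay estimate makes every smooth function Cauchy along
them. Convergence thus follows from the bound on `F` alone. -/
theorem CompactnessSetting.exists_tendsto (S : CompactnessSetting g β h F k bPlus bMinus Z b C U)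
    {T₀ : ℝ} (hT₀ : ((k : ℝ) + 1) * R + 1 ≤ T₀) {p : ℝ × (ℝ → M)}
    (hp : p ∈ boundedModuli g β h F R T₀ b) :
    (∃ z ∈ Z, Tendsto p.2 atTop (𝓝 z)) ∧ ∃ z ∈ Z, Tendsto p.2 atBot (𝓝 z) := by
  obtain ⟨T, -, hT0, hdecay⟩ := exists_exponential_decay S.cutoff S.smooth_F S.smooth_h S.locCompact
    S.mem_of_critical S.eq_zero hT₀ S.C_pos S.isOpen S.subset S.lojasiewicz
  have key : ∀ ε : ℝ, |ε| = 1 → ∃ z ∈ Z, Tendsto (fun s => p.2 (ε * s)) atTop (𝓝 z) := by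
    intro ε hε
    refine tendsto_of_le_nhdsSet_of_cauchy (n := n) S.isCompact ?_ fun f hf => ?_
    · intro V hV
      obtain ⟨W, hW, hZW, hWV⟩ := mem_nhdsSet_iff_exists.1 hV
      obtain ⟨T₂, hT₂⟩ := exists_forall_mem_of_isOpen S.cutoff S.smooth_F S.smooth_h S.locCompact
        S.mem_of_critical S.eq_zero hT₀ hW hZW
      rw [mem_map]
      filter_upwards [eventually_ge_atTop T₂] with s hs
      exact hWV (hT₂ p hp _ (by rw [abs_mul, hε, one_mul]; exact hs.trans (le_abs_self s)))
    · obtain ⟨A, -, hA⟩ := hdecay f hf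
      refine ⟨fun s => A * Real.exp (-(s / (2 * C))), ?_, ?_⟩
      · have h1 : Tendsto (fun s : ℝ => s / (2 * C)) atTop atTop :=
          tendsto_id.atTop_div_const (by have := S.C_pos; positivity)
        simpa using (Real.tendsto_exp_neg_atTop_nhds_zero.comp h1).const_mul A
      · filter_upwards [eventually_ge_atTop T] with s hs t hst
        exact hA p hp ε hε s t hs hst
  refine ⟨by simpa using key 1 (by simp), ?_⟩
  obtain ⟨z, hz, hlim⟩ := key (-1) (by simp)
  refine ⟨z, hz, (hlim.comp tendsto_neg_atBot_atTop).congr fun s => ?_⟩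
  simp

/-- For `|s| ≥ T`, let `t → ∞` in the decay estimate. For `|s| ≤ T`, the uniform bound `2 B`
suffices, and the factor `exp(T/(2C))` compensates the exponential. -/
theorem CompactnessSetting.exists_abs_sub_endStep_le
    (S : CompactnessSetting g β h F k bPlus bMinus Z b C U)
    {T₀ : ℝ} (hT₀ : ((k : ℝ) + 1) * R + 1 ≤ T₀) {f : M → ℝ}
    (hf : ContMDiff (𝓡 n) 𝓘(ℝ, ℝ) ∞ f) :
    ∃ A : ℝ, 0 ≤ A ∧ ∀ p ∈ boundedModuli g β h F R T₀ b, ∀ x y, Tendsto p.2 atBot (𝓝 x) →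
      Tendsto p.2 atTop (𝓝 y) → ∀ s, |f (p.2 s) - endStep (f x) (f y) s| ≤
        A * Real.exp (-(1 / (2 * C)) * |s|) := by
  obtain ⟨T, -, hT0, hdecay⟩ := exists_exponential_decay S.cutoff S.smooth_F S.smooth_h S.locCompact
    S.mem_of_critical S.eq_zero hT₀ S.C_pos S.isOpen S.subset S.lojasiewicz
  obtain ⟨A, hA0, hA⟩ := hdecay f hf
  obtain ⟨B, hB0, hB⟩ := S.locCompact.exists_abs_le hf.continuous
  have hC := S.C_pos
  refine ⟨max A (2 * B * Real.exp (T / (2 * C))), le_max_of_le_left hA0,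
    fun p hp x y hx hy s => ?_⟩
  have key : ∀ ε : ℝ, |ε| = 1 → ∀ z, Tendsto (fun s => p.2 (ε * s)) atTop (𝓝 z) → ∀ s, 0 ≤ s →
      |f (p.2 (ε * s)) - f z| ≤ max A (2 * B * Real.exp (T / (2 * C))) *
        Real.exp (-(1 / (2 * C)) * |s|) := by
    intro ε hε z hz s hs
    have hlim := (hf.continuous.tendsto z).comp hz
    have hexp : -(1 / (2 * C)) * |s| = -(s / (2 * C)) := by
      rw [abs_of_nonneg hs]
      ring
    rw [hexp]
    rcases le_total T s with hTs | hsT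
    · refine le_trans ?_ (mul_le_mul_of_nonneg_right (le_max_left _ _) (Real.exp_pos _).le)
      rw [abs_sub_comm]
      refine le_of_tendsto (hlim.sub_const _).abs ?_
      filter_upwards [eventually_ge_atTop s] with t ht
      exact hA p hp ε hε s t hTs ht
    · refine le_trans ?_ (mul_le_mul_of_nonneg_right (le_max_right _ _) (Real.exp_pos _).le)
      have h1 : |f z| ≤ B := le_of_tendsto hlim.abs (Eventually.of_forall fun t => hB p hp.1 _)
      have h2 : |f (p.2 (ε * s)) - f z| ≤ 2 * B := (abs_sub _ _).trans (by linarith [hB p hp.1 (ε * s)])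
      refine h2.trans ?_
      rw [mul_assoc, ← Real.exp_add]
      refine le_mul_of_one_le_right (by positivity) (Real.one_le_exp ?_)
      rw [← sub_eq_add_neg, ← sub_div]
      exact div_nonneg (sub_nonneg.2 hsT) (by positivity)
  rcases lt_or_ge s 0 with hs | hs
  · have h1 := key (-1) (by simp) x 
      ((hx.comp tendsto_neg_atTop_atBot).congr fun s => by simp) (-s)
      (by linarith)
    simpa [endStep, hs] using h1
  · have h1 := key 1 (by simp) y (by simpa using hy) s hs
    simpa [endStep, not_lt.2 hs] using h1

/-- On the ends `(f ∘ γ)' = -g(∇F, ∇f)`. This pairing is a smooth function on `M` that vanishes on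
`Z`, so the preceding estimate, applied to it, bounds the derivative. In the middle a uniform bound
suffices. -/
theorem CompactnessSetting.exists_abs_deriv_le
    (S : CompactnessSetting g β h F k bPlus bMinus Z b C U)
    {T₀ : ℝ} (hT₀ : ((k : ℝ) + 1) * R + 1 ≤ T₀) {f : M → ℝ}
    (hf : ContMDiff (𝓡 n) 𝓘(ℝ, ℝ) ∞ f) :
    ∃ A : ℝ, 0 ≤ A ∧ ∀ p ∈ boundedModuli g β h F R T₀ b, ∀ s, |deriv (fun t => f (p.2 t)) s| ≤
        A * Real.exp (-(1 / (2 * C)) * |s|) := by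
  obtain ⟨A, hA0, hA⟩ := S.exists_abs_sub_endStep_le hT₀ (contMDiff_pairing g S.smooth_F hf)
  obtain ⟨B, hB0, hB⟩ := S.locCompact.exists_abs_le (contMDiff_pairing g S.smooth_F hf).continuous
  obtain ⟨B', hB0', hB'⟩ :=
    S.locCompact.exists_abs_le (contMDiff_pairing g S.smooth_h hf).continuous
  have hC := S.C_pos
  refine ⟨max A ((B' + B) * Real.exp (T₀ / (2 * C))), le_max_of_le_left hA0, fun p hp s => ?_⟩
  obtain ⟨hr, hflow, -⟩ := mem_moduliSpace_iff.1 hp.1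
  rcases le_total T₀ |s| with hs | hs
  · have hβ0 := S.cutoff.eq_zero_of_le_abs hp.2.1 (hT₀.trans hs)
    rw [(hflow.hasDerivAt_of_eq_zero S.smooth_F S.smooth_h hf hβ0).deriv, abs_neg]
    obtain ⟨⟨y, hyZ, hy⟩, ⟨x, hxZ, hx⟩⟩ := S.exists_tendsto hT₀ hp
    have h1 := hA p hp x y hx hy s
    rw [pairing_eq_zero_of_mem_criticalSet g f (S.critical hxZ),
      pairing_eq_zero_of_mem_criticalSet g f (S.critical hyZ)] at h1
    simp only [endStep, ite_self, sub_zero] at h1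
    exact h1.trans (mul_le_mul_of_nonneg_right (le_max_left _ _) (Real.exp_pos _).le)
  · rw [(hflow.hasDerivAt S.smooth_F S.smooth_h hf s).deriv, abs_neg]
    have hβ1 := S.cutoff.mem_Icc p.1 hr s
    have h1 : |flowRate g β h F p.1 s f (p.2 s)| ≤ B' + B := by
      refine (abs_add_le _ _).trans (add_le_add ?_ ?_)
      · rw [abs_mul, abs_of_nonneg hβ1.1]
        exact (mul_le_of_le_one_left (abs_nonneg _) hβ1.2).trans (hB' p hp.1 s)
      · rw [abs_mul, abs_of_nonneg (sub_nonneg.2 hβ1.2)]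
        exact (mul_le_of_le_one_left (abs_nonneg _) (by linarith [hβ1.1])).trans (hB p hp.1 s)
    refine h1.trans (le_trans ?_
      (mul_le_mul_of_nonneg_right (le_max_right _ _) (Real.exp_pos _).le))
    rw [mul_assoc, ← Real.exp_add]
    refine le_mul_of_one_le_right (by positivity) (Real.one_le_exp ?_)
    have : T₀ / (2 * C) + -(1 / (2 * C)) * |s| = (T₀ - |s|) / (2 * C) := by ring
    rw [this]
    exact div_nonneg (sub_nonneg.2 hs) (by positivity)

end Decay

/-! ### Exchange of limits and auxiliary facts on curves -/

/-- The usual `ε/3` argument; it shows that the end points of converging gradient lines converge. -/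
theorem tendsto_of_uniform_limit {x : ℕ → ℝ → ℝ} {y δ : ℝ → ℝ} {a : ℕ → ℝ} {a₀ : ℝ} {l : Filter ℝ}
    [l.NeBot] (hx : ∀ s, Tendsto (fun j => x j s) atTop (𝓝 (y s))) (hδ : Tendsto δ l (𝓝 0))
    (ha : ∀ᶠ s in l, ∀ j, |x j s - a j| ≤ δ s) (ha₀ : ∀ᶠ s in l, |y s - a₀| ≤ δ s) :
    Tendsto a atTop (𝓝 a₀) := by
  rw [Metric.tendsto_nhds]
  intro ε hε
  obtain ⟨s, h1, h2, h3⟩ :=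
    (ha.and (ha₀.and (hδ.eventually_lt_const (by positivity : (0 : ℝ) < ε / 3)))).exists
  filter_upwards [(Metric.tendsto_nhds.1 (hx s)) (ε / 3) (by positivity)] with j hj
  rw [Real.dist_eq] at hj ⊢
  have h4 := abs_le.1 (h1 j)
  have h5 := abs_le.1 h2
  have h6 := abs_lt.1 hj
  exact abs_lt.2 ⟨by linarith, by linarith⟩

theorem tendsto_mul_exp_neg_mul_abs (A : ℝ) {μ : ℝ} (hμ : 0 < μ) {l : Filter ℝ}
    (hl : Tendsto (fun s : ℝ => |s|) l atTop) :
    Tendsto (fun s => A * Real.exp (-μ * |s|)) l (𝓝 0) := by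
  have h1 := (Real.tendsto_exp_neg_atTop_nhds_zero.comp (hl.const_mul_atTop hμ)).const_mul A
  simpa [Function.comp_def] using h1

theorem measurable_endStep (a b : ℝ) : Measurable (endStep a b) :=
  Measurable.ite measurableSet_Iio measurable_const measurable_const

theorem contDiff_comp_curve {n : ℕ} {M : Type*} [TopologicalSpace M]
    [ChartedSpace (EuclideanSpace ℝ (Fin n)) M] {f : M → ℝ} (hf : ContMDiff (𝓡 n) 𝓘(ℝ, ℝ) ∞ f) {γ : ℝ → M}
    (hγ : ContMDiff 𝓘(ℝ, ℝ) (𝓡 n) ∞ γ) : ContDiff ℝ ∞ fun s => f (γ s) :=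
  contMDiff_iff_contDiff.1 (hf.comp hγ)

theorem W12Curve.ext_of_toFun_eq {n : ℕ} {M : Type*} [TopologicalSpace M] [T2Space M]
    [ChartedSpace (EuclideanSpace ℝ (Fin n)) M] {c c' : W12Curve n M} (hcc' : c.toFun = c'.toFun) : c = c' := by
  have h1 : c.left = c'.left := tendsto_nhds_unique c.tendsto_left (hcc' ▸ c'.tendsto_left)
  have h2 : c.right = c'.right := tendsto_nhds_unique c.tendsto_right (hcc' ▸ c'.tendsto_right)
  cases c
  cases c'
  subst hcc' h1 h2
  rfl

/-! ### Compactness in the `W^{1,2}`-topology -/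

section Curves

variable {n : ℕ} {M : Type*} [TopologicalSpace M] [T2Space M]
  [ChartedSpace (EuclideanSpace ℝ (Fin n)) M]
  [IsManifold (𝓡 n) ∞ M] {g : Metric n M} {β : ℝ → ℝ → ℝ} {h F : M → ℝ} {k : ℕ}
  {bPlus bMinus : ℝ → ℝ} {Z : Set M} {b R C : ℝ} {U : Set M} {T₀ : ℝ}

theorem CompactnessSetting.exists_w12Curve
    (S : CompactnessSetting g β h F k bPlus bMinus Z b C U)
    (hT₀ : ((k : ℝ) + 1) * R + 1 ≤ T₀) {p : ℝ × (ℝ → M)}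
    (hp : p ∈ boundedModuli g β h F R T₀ b) : ∃ c : W12Curve n M, c.toFun = p.2 := by
  obtain ⟨⟨y, -, hy⟩, ⟨x, -, hx⟩⟩ := S.exists_tendsto hT₀ hp
  have hsm := (mem_moduliSpace_iff.1 hp.1).2.1.smooth
  have hμ : 0 < 1 / (2 * C) := by have := S.C_pos; positivity
  refine ⟨⟨p.2, x, y, hsm.continuous, hx, hy, fun f => ⟨fun c d => ?_, ?_, ?_⟩⟩, rfl⟩
  · exact ((contDiff_comp_curve f.contMDiff hsm).of_le (by simp)).contDiffOn
      |>.absolutelyContinuousOnInterval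
  · obtain ⟨A, -, hA⟩ := S.exists_abs_sub_endStep_le hT₀ f.contMDiff
    exact memLp_of_abs_le_exp
      ((f.contMDiff.continuous.comp hsm.continuous).measurable.sub
        (measurable_endStep _ _)).aestronglyMeasurable hμ (hA p hp x y hx hy)
  · obtain ⟨A, -, hA⟩ := S.exists_abs_deriv_le hT₀ f.contMDiff
    exact memLp_of_abs_le_exp (measurable_deriv _).aestronglyMeasurable hμ (hA p hp)

/-- Pointwise convergence of gradient lines implies convergence in `W^{1,2}`. -/
theorem CompactnessSetting.tendsto_w12Curve
    (S : CompactnessSetting g β h F k bPlus bMinus Z b C U)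
    (hT₀ : ((k : ℝ) + 1) * R + 1 ≤ T₀) {r : ℕ → ℝ} {c : ℕ → W12Curve n M} {r₀ : ℝ}
    {c₀ : W12Curve n M} (hc : ∀ j, (r j, (c j).toFun) ∈ boundedModuli g β h F R T₀ b)
    (hc₀ : (r₀, c₀.toFun) ∈ boundedModuli g β h F R T₀ b) (hr : Tendsto r atTop (𝓝 r₀))
    (hlim : ∀ s, Tendsto (fun j => (c j).toFun s) atTop (𝓝 (c₀.toFun s))) :
    Tendsto c atTop (𝓝 c₀) := by
  have hμ : 0 < 1 / (2 * C) := by have := S.C_pos; positivity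
  rw [nhds_iInf, tendsto_iInf]
  intro f
  rw [nhds_induced, tendsto_comap_iff]
  have hf := f.contMDiff
  obtain ⟨A, -, hA⟩ := S.exists_abs_sub_endStep_le hT₀ hf
  obtain ⟨A', -, hA'⟩ := S.exists_abs_deriv_le hT₀ hf
  have hbound := fun j => hA _ (hc j) _ _ (c j).tendsto_left (c j).tendsto_right
  have hbound₀ := hA _ hc₀ _ _ c₀.tendsto_left c₀.tendsto_right
  have hval : ∀ s, Tendsto (fun j => f ((c j).toFun s)) atTop (𝓝 (f (c₀.toFun s))) := fun s =>
    (hf.continuous.tendsto _).comp (hlim s)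
  have hleft : Tendsto (fun j => f (c j).left) atTop (𝓝 (f c₀.left)) := by
    refine tendsto_of_uniform_limit hval
      (tendsto_mul_exp_neg_mul_abs A hμ tendsto_abs_atBot_atTop) ?_ ?_
    · filter_upwards [eventually_lt_atBot 0] with s hs j
      simpa [endStep, hs] using hbound j s
    · filter_upwards [eventually_lt_atBot 0] with s hs
      simpa [endStep, hs] using hbound₀ s
  have hright : Tendsto (fun j => f (c j).right) atTop (𝓝 (f c₀.right)) := by
    refine tendsto_of_uniform_limit hval
      (tendsto_mul_exp_neg_mul_abs A hμ tendsto_abs_atTop_atTop) ?_ ?_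
    · filter_upwards [eventually_ge_atTop 0] with s hs j
      simpa [endStep, not_lt.2 hs] using hbound j s
    · filter_upwards [eventually_ge_atTop 0] with s hs
      simpa [endStep, not_lt.2 hs] using hbound₀ s
  have hflow : ∀ {r : ℝ} {γ : ℝ → M}, (r, γ) ∈ boundedModuli g β h F R T₀ b →
      IsFlowLine g β h F r γ := fun hp => (mem_moduliSpace_iff.1 hp.1).2.1
  refine (hleft.prodMk_nhds hright).prodMk_nhds (Tendsto.prodMk_nhds ?_ ?_)
  · rw [Lp.tendsto_Lp_iff_tendsto_eLpNorm'']
    refine tendsto_eLpNorm_two_of_dominated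
      (fun j => ((c j).isW12 f).memLp_sub.aestronglyMeasurable)
      (c₀.isW12 f).memLp_sub.aestronglyMeasurable ((memLp_exp_neg_mul_abs hμ).const_mul A) hbound
      fun s => (hval s).sub ?_
    unfold endStep
    split_ifs
    exacts [hleft, hright]
  · rw [Lp.tendsto_Lp_iff_tendsto_eLpNorm'']
    refine tendsto_eLpNorm_two_of_dominated
      (fun j => ((c j).isW12 f).memLp_deriv.aestronglyMeasurable)
      (c₀.isW12 f).memLp_deriv.aestronglyMeasurable ((memLp_exp_neg_mul_abs hμ).const_mul A')
      (fun j => hA' _ (hc j)) fun s => ?_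
    -- The gradient equation expresses the derivative through the position, so pointwise convergence
    -- of the curves and of `r` is enough.
    rw [((hflow hc₀).hasDerivAt S.smooth_F S.smooth_h hf s).deriv]
    have hd := fun j => ((hflow (hc j)).hasDerivAt S.smooth_F S.smooth_h hf s).deriv
    simp only [hd]
    have hβ := S.cutoff.tendsto (fun j => (hc j).2.1.1) hc₀.2.1.1 hr s
    have hp : ∀ f' : M → ℝ, ContMDiff (𝓡 n) 𝓘(ℝ, ℝ) ∞ f' →
        Tendsto (fun j => pairing g f' f ((c j).toFun s)) atTop
          (𝓝 (pairing g f' f (c₀.toFun s))) := fun f' hf' =>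
      ((contMDiff_pairing g hf' hf).continuous.tendsto _).comp (hlim s)
    exact ((hβ.mul (hp h S.smooth_h)).add ((hβ.const_sub 1).mul (hp F S.smooth_F))).neg

/-- The bound `|F| ≤ b` on the ends survives pointwise limits, and it gives back the finite energy
of the limit line. -/
theorem CompactnessSetting.exists_subseq
    (S : CompactnessSetting g β h F k bPlus bMinus Z b C U)
    (hT₀ : ((k : ℝ) + 1) * R + 1 ≤ T₀) {p : ℕ → ℝ × (ℝ → M)}
    (hp : ∀ j, p j ∈ boundedModuli g β h F R T₀ b) :
    ∃ p₀ ∈ boundedModuli g β h F R T₀ b, ∃ φ : ℕ → ℕ, StrictMono φ ∧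
      Tendsto (fun j => (p (φ j)).1) atTop (𝓝 p₀.1) ∧
      ∀ s, Tendsto (fun j => (p (φ j)).2 s) atTop (𝓝 (p₀.2 s)) := by
  obtain ⟨r₀, hr₀, φ, hφ, hr⟩ := isCompact_Icc.tendsto_subseq fun j => (hp j).2.1
  obtain ⟨ψ, hψ, η, hη⟩ := S.locCompact (fun j => (p (φ j)).1) (fun j => (p (φ j)).2) (fun _ => 0)
    fun j => (hp (φ j)).1
  have hr' : Tendsto (fun j => (p (φ (ψ j))).1) atTop (𝓝 r₀) := hr.comp hψ.tendsto_atTop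
  have hlim : ∀ s, Tendsto (fun j => (p (φ (ψ j))).2 s) atTop (𝓝 (η s)) := fun s => by
    simpa using hη.tendsto s
  have hflow : IsFlowLine g β h F r₀ η := IsFlowLine.of_tendsto S.smooth_F S.smooth_h
    (r := fun j => (p (φ (ψ j))).1) (γ := fun j => (p (φ (ψ j))).2) (σ := fun _ => 0)
    (fun j => (mem_moduliSpace_iff.1 (hp (φ (ψ j))).1).2.1) hη fun s => by
      simpa using S.cutoff.tendsto (fun j => (hp (φ (ψ j))).2.1.1) hr₀.1 hr' s
  have hbd : ∀ s, T₀ ≤ |s| → |F (η s)| ≤ b := fun s hs =>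
    le_of_tendsto ((S.smooth_F.continuous.tendsto _).comp (hlim s)).abs
      (Eventually.of_forall fun j => (hp (φ (ψ j))).2.2 s hs)
  refine ⟨(r₀, η), ⟨mem_moduliSpace_iff.2 ⟨hr₀.1, hflow, hflow.energy_lt_top S.cutoff hr₀.1
    S.smooth_F S.smooth_h (fun s hs => S.cutoff.eq_zero_of_le_abs hr₀ (hT₀.trans hs)) hbd⟩, hr₀, hbd⟩,
    φ ∘ ψ, hφ.comp hψ, hr', hlim⟩

theorem eq_of_eqOn_rat {γ γ' : ℝ → M} (hγ : Continuous γ) (hγ' : Continuous γ')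
    (hq : ∀ q : ℚ, γ q = γ' q) : γ = γ' :=
  Rat.denseRange_cast.equalizer hγ hγ' (funext hq)

/-- The `W^{1,2}`-topology is induced by all smooth functions at once, so sequential compactness is
not used there to conclude compactness. It is used in the metrizable space `ℝ × (ℚ → M)`, and the
compact set found there is mapped continuously onto the moduli space. -/
theorem CompactnessSetting.isCompact_w12Curve [SecondCountableTopology M]
    (S : CompactnessSetting g β h F k bPlus bMinus Z b C U)
    (hT₀ : ((k : ℝ) + 1) * R + 1 ≤ T₀) :
    IsCompact {q : ℝ × W12Curve n M | (q.1, q.2.toFun) ∈ boundedModuli g β h F R T₀ b} := by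
  have : LocallyCompactSpace M := ChartedSpace.locallyCompactSpace (EuclideanSpace ℝ (Fin n)) M
  have : TopologicalSpace.MetrizableSpace M :=
    TopologicalSpace.metrizableSpace_of_t3_secondCountable M
  have hcontOf : ∀ {p : ℝ × (ℝ → M)}, p ∈ boundedModuli g β h F R T₀ b → Continuous p.2 :=
    fun hp => (mem_moduliSpace_iff.1 hp.1).2.1.smooth.continuous
  -- gradient lines are encoded by their values at rational times
  let enc : ℝ × (ℝ → M) → ℝ × (ℚ → M) := fun p => (p.1, fun q => p.2 q)
  let A : Set (ℝ × (ℚ → M)) := enc '' boundedModuli g β h F R T₀ b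
  have hA : IsSeqCompact A := by
    intro x hx
    choose p hp hpx using hx
    obtain ⟨p₀, hp₀, φ, hφ, hr, hlim⟩ := S.exists_subseq hT₀ hp
    refine ⟨enc p₀, mem_image_of_mem _ hp₀, φ, hφ, ?_⟩
    have h1 : x ∘ φ = fun j => enc (p (φ j)) := funext fun j => (hpx (φ j)).symm
    rw [h1]
    exact hr.prodMk_nhds (tendsto_pi_nhds.2 fun q => hlim q)
  have : CompactSpace A := isCompact_iff_compactSpace.1 hA.isCompact
  choose p hp hpx using fun x : A => x.2
  choose c hc using fun x : A => S.exists_w12Curve hT₀ (hp x)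
  have hpc : ∀ x, ((p x).1, (c x).toFun) ∈ boundedModuli g β h F R T₀ b := fun x => by
    rw [hc x]
    exact hp x
  have hfst : ∀ x : A, (p x).1 = x.1.1 := fun x => congrArg Prod.fst (hpx x)
  have hsnd : ∀ (x : A) (q : ℚ), (p x).2 q = x.1.2 q := fun x q =>
    congrFun (congrArg Prod.snd (hpx x)) q
  have hcont : Continuous fun x : A => ((p x).1, c x) := by
    refine Continuous.prodMk ?_ ?_
    · simp only [hfst]
      fun_prop
    -- Every subsequence has a further one converging to some line `p₀`; agreement at rational times
    -- identifies `p₀` with the line encoded by `x₀`.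
    · refine SeqContinuous.continuous fun x x₀ hx => tendsto_of_subseq_tendsto fun ns hns => ?_
      obtain ⟨p₀, hp₀, φ, hφ, hr, hlim⟩ := S.exists_subseq hT₀ fun j => hp (x (ns j))
      have hx' : Tendsto (fun j => (x (ns (φ j))).1) atTop (𝓝 x₀.1) :=
        (continuous_subtype_val.tendsto _).comp (hx.comp (hns.comp hφ.tendsto_atTop))
      have h1 : p₀.1 = (p x₀).1 := by
        rw [hfst]
        simp only [hfst] at hr
        exact tendsto_nhds_unique hr ((continuous_fst.tendsto _).comp hx')
      have h2 : p₀.2 = (p x₀).2 := eq_of_eqOn_rat (hcontOf hp₀) (hcontOf (hp x₀)) fun q => by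
        have h3 := hlim q
        simp only [hsnd] at h3
        rw [hsnd]
        exact tendsto_nhds_unique h3
          (((continuous_apply q).tendsto _).comp ((continuous_snd.tendsto _).comp hx'))
      refine ⟨φ, S.tendsto_w12Curve hT₀ (fun j => hpc _) (hpc x₀) (h1 ▸ hr) fun s => ?_⟩
      simp only [Function.comp_apply, hc, ← h2]
      exact hlim s
  convert isCompact_range hcont using 1
  refine Subset.antisymm (fun q hq => ?_) (by rintro _ ⟨x, rfl⟩; exact hpc x)
  let x : A := ⟨enc (q.1, q.2.toFun), mem_image_of_mem _ hq⟩
  refine ⟨x, Prod.ext (hfst x) (W12Curve.ext_of_toFun_eq ?_)⟩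
  rw [hc x]
  exact eq_of_eqOn_rat (hcontOf (hp x)) q.2.continuous (hsnd x)

/-- The action estimate gives one inclusion, the forced convergence of the ends the other. -/
theorem CompactnessSetting.moduliSpaceIcc_eq
    (S : CompactnessSetting g β h F k bPlus bMinus Z b C U) {m K : ℝ} (hb : b = K - m)
    (hhF : ∀ x, m ≤ h x - F x ∧ h x - F x ≤ K) :
    moduliSpaceIcc g β h F Z R = boundedModuli g β h F R (((k : ℝ) + 1) * R + 1) b := by
  ext p
  refine ⟨fun ⟨hp, hr, ⟨y, hyZ, hy⟩, ⟨x, hxZ, hx⟩⟩ => ⟨hp, hr, fun s hs => ?_⟩,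
    fun hp => ⟨hp.1, hp.2.1, S.exists_tendsto le_rfl hp⟩⟩
  have hlim : ∀ {z : M} {l : Filter ℝ}, z ∈ Z → Tendsto p.2 l (𝓝 z) →
      Tendsto (fun s => F (p.2 s)) l (𝓝 0) := fun {z l} hz hl => by
    rw [← S.eq_zero z hz]
    exact (S.smooth_F.continuous.tendsto z).comp hl
  rw [hb]
  refine (mem_moduliSpace_iff.1 hp).2.1.abs_le_of_tendsto S.cutoff hr.1 S.smooth_F S.smooth_h hhF
    (hlim hyZ hy) (hlim hxZ hx) ?_
  have hk : ((k : ℝ) + 1) * p.1 ≤ (k + 1) * R := mul_le_mul_of_nonneg_left hr.2 (by positivity)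
  have hk0 : 0 ≤ ((k : ℝ) + 1) * p.1 := mul_nonneg (by positivity) hr.1
  rcases le_total 0 s with h0 | h0
  · rw [abs_of_nonneg h0] at hs
    exact Or.inr (by linarith)
  · rw [abs_of_nonpos h0] at hs
    exact Or.inl (by linarith)

end Curves

end MorseBott

/-! ### The compactness theorem -/

theorem theorem3p6
    {n d : ℕ}
    {M : Type*} [TopologicalSpace M] [T2Space M] [SecondCountableTopology M]
    [ChartedSpace (EuclideanSpace ℝ (Fin n)) M] [IsManifold (𝓡 n) ∞ M]
    {N : Type*} [TopologicalSpace N] [CompactSpace N] [ConnectedSpace N]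
    [ChartedSpace (EuclideanSpace ℝ (Fin d)) N] [IsManifold (𝓡 d) ∞ N]
    (ι : N → M) (hι : IsSmoothEmbedding (𝓡 d) (𝓡 n) ∞ ι)
    (g : MorseBott.Metric n M)
    (F h : M → ℝ)
    (hF : ContMDiff (𝓡 n) 𝓘(ℝ, ℝ) ∞ F) (hh : ContMDiff (𝓡 n) 𝓘(ℝ, ℝ) ∞ h)
    (hMB : MorseBott.IsMorseBottAlong (n := n) (d := d) F ι)
    (hFZ : ∀ z ∈ Set.range ι, F z = 0)
    (hgap : 0 < MorseBott.spectralGap n F (Set.range ι))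
    (k : ℕ) (bPlus bMinus : ℝ → ℝ) (β : ℝ → ℝ → ℝ)
    (hβ : MorseBott.IsCutoffFamily k bPlus bMinus β)
    (hosc : MorseBott.oscillation (fun x => h x - F x) < MorseBott.spectralGap n F (Set.range ι))
    (hcpt : MorseBott.SmoothLocCompactness g β h F)
    (R : ℝ) (hR : 0 ≤ R) :
    (∀ p ∈ MorseBott.moduliSpaceIcc g β h F (Set.range ι) R,
      ∃ c : MorseBott.W12Curve n M, c.toFun = p.2) ∧
    IsCompact {q : ℝ × MorseBott.W12Curve n M |
      (q.1, q.2.toFun) ∈ MorseBott.moduliSpaceIcc g β h F (Set.range ι) R} := by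
  have hιs : ContMDiff (𝓡 d) (𝓡 n) ∞ ι := hι.contMDiff
  have : Nonempty M := ⟨ι (Classical.arbitrary N)⟩
  obtain ⟨m, K, hmK, hlt⟩ := MorseBott.exists_bounds_of_oscillation_lt hosc
  obtain ⟨C, hC, U, hU, hZU, hloj⟩ := MorseBott.exists_lojasiewicz g hF hιs hMB hFZ
  have S : MorseBott.CompactnessSetting g β h F k bPlus bMinus (range ι) (K - m) C U :=
    { cutoff := hβ
      smooth_F := hF
      smooth_h := hh
      locCompact := hcpt
      mem_of_critical := fun x hx hxb => by
        by_contra hxZ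
        have h1 : MorseBott.spectralGap n F (range ι) ≤ ((|F x| : ℝ) : EReal) :=
          iInf₂_le x ⟨hx, hxZ⟩
        exact absurd (EReal.coe_lt_coe_iff.1 (hlt.trans_le h1)) (not_lt.2 hxb)
      critical := hMB.1
      eq_zero := hFZ
      isCompact := isCompact_range hιs.continuous
      C_pos := hC
      isOpen := hU
      subset := hZU
      lojasiewicz := hloj }
  rw [S.moduliSpaceIcc_eq rfl hmK]
  exact ⟨fun p hp => S.exists_w12Curve le_rfl hp, S.isCompact_w12Curve le_rfl⟩
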